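/- **Conventions.** A *train track* is a locally finite graph in which, at each vertex (switch), the incident ends of edges (branches) are partitioned into two nonempty totally ordered sets, the incoming and the outgoing ones. A *weight system* $w\ge 0$ on the branches has equal incoming and outgoing total weight $\ell_v$ at each switch $v$. Glue the rectangles $R(b)=[0,1]\times[0,w(b)]$ along their vertical sides to the intervals $I(v)=[0,\ell_v]$, where the ends on each side of $v$ occupy consecutive subintervals in the given order; a left side at an outgoing end and a right side at an incoming end is glued by a translation, the other sides by a rotation by $\pi$. A *singularity* is a point of some $I(v)$ at which at least three rectangle ends meet. A *leaf* is a bi-infinite concatenation of horizontal segments $\dots\sigma_{-1}\sigma_0\sigma_1\dots$ (it may run along the same segment more than once), $\sigma_i$ crossing $R(b_i)$, such that at each switch it passes from an incoming to an outgoing end or conversely, and such that for a fixed choice of left or right: if $\sigma_i$ lies in the interior of its rectangle (off the horizontal boundary) and ends at a singularity, then $R(b_{i+1})$ lies on the chosen hand there; and if $\sigma_i$ lies in the interior of its rectangle and starts at a singularity, then $R(b_{i-1})$ lies there on the opposite hand, as seen when $\sigma_i$ is traversed backwards. $\mathcal{TP}(T,w)$ is the set of train paths $\dots b_{-1}b_0b_1\dots$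 of leaves; these are edge paths (a loop is traversed in one of two directions), up to reparametrization and reversal. A path $t\in\mathcal{TP}(T,w)$ is *dense* if it contains every finite subpath of every $t'\in\mathcal{TP}(T,w)$, in either direction. A *half train path* is an equivalence class of rays contained in some $t\in\mathcal{TP}(T,w)$, two rays in the same $t$ being equivalent if their symmetric difference is finite (so each $t$ has two half train paths, and half train paths of different $t$ are different); it is dense if each of its rays contains every finite subpath of every $t'\in\mathcal{TP}(T,w)$, in either direction. **The tracks.** $T_1$ has switches $A$, $B$, $C$ and $S_k,Q_k,F_k$ ($k\ge0$). Its branches, with their weights $w_1$ and written from left end to right end, are $e_1$ ($\tfrac13$) and $e_2$ ($\tfrac23$) from $A$ to $B$; $m$ ($1$) from $B$ to $C$; a loop $m'$ ($\tfrac12$) at $C$; and for $k\ge 0$: $s_0$ ($1$) from $S_0$ to $A$ and $s_{k+1}$ ($4^{-(k+1)}$) from $S_{k+1}$ to $Q_k$; $x_k$ ($3\cdot4^{-(k+1)}$) from $Q_k$ to $S_k$; $y_k$ ($4^{-(k+1)}$) from $F_k$ to $S_k$; a loop $z_k$ ($\tfrac1{8\cdot4^k}$) at $F_k$; a loop $q_k$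 ($4^{-(k+1)}$) at $Q_k$. The ends, in increasing order, are (incoming | outgoing; superscripts $-$, $+$ denote left and right ends): at $A$: $s_0^+ \mid e_1^-,e_2^-$; at $B$: $e_1^+,e_2^+\mid m^-$; at $C$: $m^+\mid m'^-,m'^+$; at $S_k$: $x_k^+,y_k^+\mid s_k^-$; at $Q_k$: $q_k^+,s_{k+1}^+,q_k^-\mid x_k^-$; at $F_k$: $z_k^+,z_k^-\mid y_k^-$. For $n\ge1$ let $\pi_n:T_n\to T_1$ be the $n$-fold cyclic cover with sheets indexed by $\mathbb Z/n$ in which the lift of a branch $b$ starting on sheet $i$ at its left end has its right end on sheet $i$ if $b\ne e_1$, and on sheet $i+1$ if $b=e_1$; thus the bigon $c=e_1\cup e_2$ has a unique lift, which covers $c$ with degree $n$. Let $w_n=w_1\circ\pi_n$. **Theorem.** For every $n\ge 1$, every train path in $\mathcal{TP}(T_n,w_n)$ is dense. Moreover, every half train path of $\mathcal{TP}(T_n,w_n)$ is dense except for exactly $2n$ of them. -/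

import Mathlib

/-! ## Train tracks and weight systems -/

/-- The two sides of a switch. -/
inductive Side
  | incoming
  | outgoing

/-- The other side of a switch. -/
def Side.opp : Side → Side
  | .incoming => .outgoing
  | .outgoing => .incoming

/-- The two ends of a branch `b`; the rectangle `R(b) = [0,1] × [0,w(b)]` has the vertical side
`{0} × [0,w(b)]` at the left end and `{1} × [0,w(b)]` at the right end. -/
inductive End
  | left
  | right

/-- The other end of a branch. -/
def End.opp : End → End
  | .left => .right
  | .right => .left

/-- A train track: a locally finite graph such that at each switch the finite set of incident
branch ends (a loop has two of them) is partitioned into a nonempty set of incoming ends and a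
nonempty set of outgoing ends, each of the two totally ordered. A finite totally ordered set is
given as the duplicate-free list of its elements in increasing order. -/
structure TrainTrack where
  /-- The vertices. -/
  Switch : Type
  /-- The edges. -/
  Branch : Type
  /-- The incoming and the outgoing branch ends at a switch, in increasing order. -/
  ends : Switch → Side → List (Branch × End)
  ends_ne_nil : ∀ v s, ends v s ≠ []
  ends_nodup : ∀ v s, (ends v s).Nodup
  /-- Every end of every branch is attached to exactly one side of exactly one switch. -/
  exists_unique : ∀ e : Branch × End, ∃! p : Switch × Side, e ∈ ends p.1 p.2

namespace TrainTrack

/-- A branch together with a direction: `(b, ε)` is the branch `b`, traversed starting from its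
end `ε`. -/
abbrev DirectedBranch (T : TrainTrack) : Type := T.Branch × End

/-- The same branch, traversed in the other direction. -/
def DirectedBranch.flip {T : TrainTrack} (d : T.DirectedBranch) : T.DirectedBranch :=
  (d.1, d.2.opp)

/-- A weight system: nonnegative weights on the branches satisfying the switch conditions. -/
structure WeightSystem (T : TrainTrack) where
  /-- The weight of a branch. -/
  weight : T.Branch → ℝ
  nonneg : ∀ b, 0 ≤ weight b
  switch_condition : ∀ v,
    ((T.ends v .incoming).map fun e => weight e.1).sum =
      ((T.ends v .outgoing).map fun e => weight e.1).sum

variable {T : TrainTrack}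

namespace WeightSystem

/-! ## The union of foliated rectangles

The branch ends on each side of a switch `v` divide `I(v) = [0,ℓ]` into consecutive intervals, in
the given order, and the vertical sides of the rectangles are glued to these intervals. The gluing
is by a translation for a left end on the outgoing side and for a right end on the incoming side,
and by a rotation by `π` otherwise, so that the result is oriented. -/

/-- The end `e` is attached to the side `s` of the switch `v`, along the subinterval
`[lo, lo + w(e)]` of `I(v)`. -/
def AttachedAt (w : T.WeightSystem) (v : T.Switch) (s : Side) (e : T.Branch × End) (lo : ℝ) :
    Prop :=
  ∃ pre post, T.ends v s = pre ++ e :: post ∧ lo = (pre.map fun e' => w.weight e'.1).sum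

/-- The coordinate, relative to the lower end of the subinterval of `I(v)`, to which the point at
height `h` on the vertical side `e` is glued, if `e` is attached to the side `s`. -/
def glue (w : T.WeightSystem) : Side → T.Branch × End → ℝ → ℝ
  | .outgoing, (_, .left), h => h
  | .incoming, (_, .right), h => h
  | .outgoing, (b, .right), h => w.weight b - h
  | .incoming, (b, .left), h => w.weight b - h

/-- The point at height `h` on the vertical side `e` is glued to the point `x` of `I(v)`, from the
side `s` of `v`. -/
def GluedTo (w : T.WeightSystem) (e : T.Branch × End) (h : ℝ) (v : T.Switch) (s : Side) (x : ℝ) :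
    Prop :=
  ∃ lo, w.AttachedAt v s e lo ∧ x = lo + w.glue s e h

/-- The rectangle end `e` contains the point `x` of `I(v)`. -/
def Meets (w : T.WeightSystem) (e : T.Branch × End) (v : T.Switch) (x : ℝ) : Prop :=
  ∃ s, ∃ h ∈ Set.Icc 0 (w.weight e.1), w.GluedTo e h v s x

/-- The point `x` of `I(v)` is a singularity: at least three rectangle ends meet there. -/
def IsSingular (w : T.WeightSystem) (v : T.Switch) (x : ℝ) : Prop :=
  ∃ e₁ e₂ e₃, e₁ ≠ e₂ ∧ e₁ ≠ e₃ ∧ e₂ ≠ e₃ ∧ w.Meets e₁ v x ∧ w.Meets e₂ v x ∧ w.Meets e₃ v x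

/-- A horizontal segment `[0,1] × {h}` of a rectangle, with a direction in which it is
traversed. -/
structure Segment (w : T.WeightSystem) where
  /-- The branch whose rectangle is traversed, with its direction. -/
  dir : T.DirectedBranch
  /-- The height in the rectangle. -/
  height : ℝ
  height_mem : height ∈ Set.Icc 0 (w.weight dir.1)

namespace Segment

variable {w : T.WeightSystem}

/-- The segment lies in the interior of the rectangle, i.e. not on its horizontal boundary. -/
def IsInterior (σ : w.Segment) : Prop := σ.height ∈ Set.Ioo 0 (w.weight σ.dir.1)

/-- `σ` starts at the point `x` of `I(v)`, its rectangle being on the side `s` of `v`. -/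
def StartsAt (σ : w.Segment) (v : T.Switch) (s : Side) (x : ℝ) : Prop :=
  w.GluedTo σ.dir σ.height v s x

/-- `σ` ends at the point `x` of `I(v)`, its rectangle being on the side `s` of `v`. -/
def EndsAt (σ : w.Segment) (v : T.Switch) (s : Side) (x : ℝ) : Prop :=
  w.GluedTo σ.dir.flip σ.height v s x

/-- `τ` starts where `σ` ends, and one of them is on the incoming and the other on the outgoing
side of the switch. -/
def Follows (σ τ : w.Segment) : Prop :=
  ∃ v s x, σ.EndsAt v s x ∧ τ.StartsAt v s.opp x

end Segment

/-- Left and right, as seen by somebody moving along a path. -/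
inductive Hand
  | left
  | right

/-- The opposite hand. -/
def Hand.opp : Hand → Hand
  | .left => .right
  | .right => .left

/-- On crossing the switch `v` at the point `x` of `I(v)`, coming from the side `s`, the rectangle
end `e` on the opposite side of `v` lies on the given hand of the point `x`: above `x` when turning
left while moving from the incoming to the outgoing side, and so on. -/
def LiesOn (w : T.WeightSystem) (k : Hand) (v : T.Switch) (s : Side) (x : ℝ) (e : T.Branch × End) :
    Prop :=
  ∃ lo, w.AttachedAt v s.opp e lo ∧
    match s, k with
    | .incoming, .left => lo = x
    | .incoming, .right => lo + w.weight e.1 = x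
    | .outgoing, .left => lo + w.weight e.1 = x
    | .outgoing, .right => lo = x

/-- A (parametrized) leaf of the singular foliation: a bi-infinite concatenation of horizontal
segments following a train path such that, for a fixed choice of left or right: whenever a segment
in the interior of its rectangle ends at a singularity, the next rectangle lies on the chosen hand;
and whenever a segment in the interior of its rectangle starts at a singularity, the previous
rectangle lies on the opposite hand as seen when the segment is traversed backwards. -/
def IsLeaf (w : T.WeightSystem) (σ : ℤ → w.Segment) : Prop :=
  (∀ i, (σ i).Follows (σ (i + 1))) ∧
  ∃ k : Hand,
    (∀ i v s x, (σ i).IsInterior → (σ i).EndsAt v s x → w.IsSingular v x →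
      w.LiesOn k v s x (σ (i + 1)).dir) ∧
    (∀ i v s x, (σ i).IsInterior → (σ i).StartsAt v s x → w.IsSingular v x →
      w.LiesOn k.opp v s x (σ (i - 1)).dir.flip)

/-! ## Train paths -/

/-- The (parametrized) train paths defined by the leaves of the foliation. -/
def TP (w : T.WeightSystem) : Set (ℤ → T.DirectedBranch) :=
  {t | ∃ σ : ℤ → w.Segment, w.IsLeaf σ ∧ ∀ i, t i = (σ i).dir}

end WeightSystem

/-- The finite path `u` is read off from `t` along consecutive indices that all lie in `S`. -/
def ReadsIn (t : ℤ → T.DirectedBranch) (S : Set ℤ) (u : List T.DirectedBranch) : Prop :=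
  ∃ c : ℤ, ∀ j : Fin u.length, c + (j : ℤ) ∈ S ∧ t (c + (j : ℤ)) = u.get j

/-- The finite path `u` is contained in the part of `t` indexed by `S`; paths are unoriented, so
`u` may also be traversed backwards. -/
def ContainedIn (u : List T.DirectedBranch) (t : ℤ → T.DirectedBranch) (S : Set ℤ) : Prop :=
  ReadsIn t S u ∨ ReadsIn t S (u.map DirectedBranch.flip).reverse

/-- The part of `t` indexed by `S` accumulates onto `t'`: it contains every finite subpath of
`t'`. -/
def AccumulatesOnto (t : ℤ → T.DirectedBranch) (S : Set ℤ) (t' : ℤ → T.DirectedBranch) : Prop :=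
  ∀ u, ContainedIn u t' Set.univ → ContainedIn u t S

namespace WeightSystem

variable (w : T.WeightSystem)

/-- A train path is dense if it accumulates onto every train path of the system. -/
def IsDense (t : ℤ → T.DirectedBranch) : Prop :=
  ∀ t' ∈ w.TP, AccumulatesOnto t Set.univ t'

/-- A ray in a train path of the system: the path, oriented in the direction of the ray, and the
index at which the ray starts. -/
abbrev Ray : Type := w.TP × ℤ

/-- Two rays are equivalent if they lie in the same train path and have finite symmetric
difference, i.e. if the oriented paths agree up to a shift of the indices. -/
instance raySetoid : Setoid w.Ray where
  r r₁ r₂ := ∃ c : ℤ, ∀ i, r₂.1.1 i = r₁.1.1 (i + c)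
  iseqv :=
    { refl := fun _ => ⟨0, fun i => by rw [add_zero]⟩
      symm := fun {x y} ⟨c, h⟩ => ⟨-c, fun i => by rw [h, neg_add_cancel_right]⟩
      trans := fun {x y z} ⟨c, h⟩ ⟨c', h'⟩ => ⟨c' + c, fun i => by rw [h', h, add_assoc]⟩ }

/-- A half train path: an equivalence class of rays contained in a train path. -/
def HalfTrainPath : Type := Quotient w.raySetoid

/-- A half train path is dense if each of its rays accumulates onto every train path of the
system. -/
def HalfTrainPath.IsDense {w : T.WeightSystem} (H : w.HalfTrainPath) : Prop :=
  ∀ r : w.Ray, Quotient.mk w.raySetoid r = H →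
    ∀ t' ∈ w.TP, AccumulatesOnto r.1.1 (Set.Ici r.2) t'

end WeightSystem

/-! ## Cyclic covers -/

/-- The lift to the sheet `i` of a switch of a branch end at this switch. -/
def liftEnd {B : Type} {n : ℕ} (c : B → ZMod n) (i : ZMod n) : B × End → (B × ZMod n) × End
  | (b, .left) => ((b, i), .left)
  | (b, .right) => ((b, i - c b), .right)

lemma liftEnd_injective {B : Type} {n : ℕ} (c : B → ZMod n) (i : ZMod n) :
    Function.Injective (liftEnd c i) := by
  rintro ⟨b, _ | _⟩ ⟨b', _ | _⟩ h <;> simp_all [liftEnd]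

lemma liftEnd_fst {B : Type} {n : ℕ} (c : B → ZMod n) (i : ZMod n) (e : B × End) :
    (liftEnd c i e).1.1 = e.1 := by
  rcases e with ⟨b, _ | _⟩ <;> rfl

/-- The cyclic cover with `n` sheets determined by `c`: the lift `(b, i)` of the branch `b` has its
left end on the sheet `i` and its right end on the sheet `i + c b`. The covering map is the first
projection. -/
def cyclicCover (T : TrainTrack) (n : ℕ) (c : T.Branch → ZMod n) : TrainTrack where
  Switch := T.Switch × ZMod n
  Branch := T.Branch × ZMod n
  ends v s := (T.ends v.1 s).map (liftEnd c v.2)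
  ends_ne_nil v s := by simpa using T.ends_ne_nil v.1 s
  ends_nodup v s := (T.ends_nodup v.1 s).map (liftEnd_injective c v.2)
  exists_unique := by
    rintro ⟨⟨b, j⟩, ε⟩
    obtain ⟨⟨v, s⟩, hv, huniq⟩ := T.exists_unique (b, ε)
    cases ε with
    | left =>
      refine ⟨((v, j), s), List.mem_map.2 ⟨_, hv, rfl⟩, ?_⟩
      rintro ⟨⟨v', j'⟩, s'⟩ h
      obtain ⟨⟨b', _ | _⟩, he, h'⟩ := List.mem_map.1 h
      · simp only [liftEnd, Prod.mk.injEq, and_true] at h'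
        obtain ⟨rfl, rfl⟩ := h'
        have := huniq (v', s') he
        simp_all
      · simp [liftEnd] at h'
    | right =>
      refine ⟨((v, j + c b), s), List.mem_map.2 ⟨_, hv, by simp [liftEnd]⟩, ?_⟩
      rintro ⟨⟨v', j'⟩, s'⟩ h
      obtain ⟨⟨b', _ | _⟩, he, h'⟩ := List.mem_map.1 h
      · simp [liftEnd] at h'
      · simp only [liftEnd, Prod.mk.injEq, and_true] at h'
        obtain ⟨rfl, rfl⟩ := h'
        have := huniq (v', s') he
        simp_all

/-- The pull-back of a weight system to a cyclic cover. -/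
def WeightSystem.pullback (w : T.WeightSystem) (n : ℕ) (c : T.Branch → ZMod n) :
    (T.cyclicCover n c).WeightSystem where
  weight b := w.weight b.1
  nonneg b := w.nonneg b.1
  switch_condition v := by
    have h : ∀ s, (((T.cyclicCover n c).ends v s).map fun e => w.weight e.1.1) =
        (T.ends v.1 s).map fun e => w.weight e.1 := by
      intro s
      simp only [cyclicCover, List.map_map]
      refine List.map_congr_left fun e _ => ?_
      exact congrArg w.weight (liftEnd_fst c v.2 e)
    rw [h, h]
    exact w.switch_condition v.1

end TrainTrack

/-! ## The weighted train tracks `(T₁, w₁)` and `(Tₙ, wₙ)` -/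

namespace CoverTrack

open TrainTrack

/-- The switches of `T₁`. -/
inductive Switch₁
  /-- the left vertex of the bigon -/
  | bigonLeft
  /-- the right vertex of the bigon -/
  | bigonRight
  /-- the base point of the loop of weight `1/2` -/
  | base
  /-- the trivalent switch at which the weight `4⁻ᵏ` is split into `3·4⁻⁽ᵏ⁺¹⁾ + 4⁻⁽ᵏ⁺¹⁾` -/
  | split (k : ℕ)
  /-- the quadrivalent switch carrying a loop of weight `4⁻⁽ᵏ⁺¹⁾` -/
  | quad (k : ℕ)
  /-- the trivalent switch carrying a loop of weight `1/(8·4ᵏ)` -/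
  | tri (k : ℕ)

/-- The branches of `T₁`. -/
inductive Branch₁
  /-- the branch of the bigon of weight `1/3` -/
  | e₁
  /-- the branch of the bigon of weight `2/3` -/
  | e₂
  /-- the branch of weight `1` from the bigon to the loop of weight `1/2` -/
  | main
  /-- the loop of weight `1/2` -/
  | mainLoop
  /-- the branch of weight `4⁻ᵏ` ending in `split k`, from the bigon or from `quad (k - 1)` -/
  | spine (k : ℕ)
  /-- the branch of weight `3·4⁻⁽ᵏ⁺¹⁾` between `split k` and `quad k` -/
  | mid (k : ℕ)
  /-- the branch of weight `4⁻⁽ᵏ⁺¹⁾` between `split k` and `tri k` -/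
  | stem (k : ℕ)
  /-- the loop of weight `1/(8·4ᵏ)` based at `tri k` -/
  | triLoop (k : ℕ)
  /-- the loop of weight `4⁻⁽ᵏ⁺¹⁾` based at `quad k` -/
  | quadLoop (k : ℕ)

open Switch₁ Branch₁ in
/-- The incoming and outgoing branch ends at the switches of `T₁`. -/
def ends₁ : Switch₁ → Side → List (Branch₁ × End)
  | bigonLeft, .incoming => [(spine 0, .right)]
  | bigonLeft, .outgoing => [(e₁, .left), (e₂, .left)]
  | bigonRight, .incoming => [(e₁, .right), (e₂, .right)]
  | bigonRight, .outgoing => [(main, .left)]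
  | base, .incoming => [(main, .right)]
  | base, .outgoing => [(mainLoop, .left), (mainLoop, .right)]
  | split k, .incoming => [(mid k, .right), (stem k, .right)]
  | split k, .outgoing => [(spine k, .left)]
  | quad k, .incoming => [(quadLoop k, .right), (spine (k + 1), .right), (quadLoop k, .left)]
  | quad k, .outgoing => [(mid k, .left)]
  | tri k, .incoming => [(triLoop k, .right), (triLoop k, .left)]
  | tri k, .outgoing => [(stem k, .left)]

/-- The switch and the side to which a branch end of `T₁` is attached. -/
def place₁ : Branch₁ × End → Switch₁ × Side
  | (.e₁, .left) => (.bigonLeft, .outgoing)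
  | (.e₁, .right) => (.bigonRight, .incoming)
  | (.e₂, .left) => (.bigonLeft, .outgoing)
  | (.e₂, .right) => (.bigonRight, .incoming)
  | (.main, .left) => (.bigonRight, .outgoing)
  | (.main, .right) => (.base, .incoming)
  | (.mainLoop, _) => (.base, .outgoing)
  | (.spine k, .left) => (.split k, .outgoing)
  | (.spine 0, .right) => (.bigonLeft, .incoming)
  | (.spine (k + 1), .right) => (.quad k, .incoming)
  | (.mid k, .left) => (.quad k, .outgoing)
  | (.mid k, .right) => (.split k, .incoming)
  | (.stem k, .left) => (.tri k, .outgoing)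
  | (.stem k, .right) => (.split k, .incoming)
  | (.triLoop k, _) => (.tri k, .incoming)
  | (.quadLoop k, _) => (.quad k, .incoming)

lemma mem_ends₁_place₁ (e : Branch₁ × End) : e ∈ ends₁ (place₁ e).1 (place₁ e).2 := by
  rcases e with ⟨_ | _ | _ | _ | (_ | k) | k | k | k | k, _ | _⟩ <;> simp [place₁, ends₁]

lemma eq_place₁ {e : Branch₁ × End} {p : Switch₁ × Side} (h : e ∈ ends₁ p.1 p.2) :
    p = place₁ e := by
  rcases p with ⟨_ | _ | _ | k | k | k, _ | _⟩ <;>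
    simp only [ends₁, List.mem_cons, List.not_mem_nil, or_false] at h <;>
    rcases h with rfl | rfl | rfl <;> rfl

/-- The train track `T₁`. -/
def T₁ : TrainTrack where
  Switch := Switch₁
  Branch := Branch₁
  ends := ends₁
  ends_ne_nil := by rintro (_ | _ | _ | k | k | k) (_ | _) <;> simp [ends₁]
  ends_nodup := by rintro (_ | _ | _ | k | k | k) (_ | _) <;> simp [ends₁]
  exists_unique e := ⟨place₁ e, mem_ends₁_place₁ e, fun _ h => eq_place₁ h⟩

/-- The weights of the branches of `T₁`. -/
noncomputable def weight₁ : Branch₁ → ℝ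
  | .e₁ => 1 / 3
  | .e₂ => 2 / 3
  | .main => 1
  | .mainLoop => 1 / 2
  | .spine k => 1 / 4 ^ k
  | .mid k => 3 / 4 ^ (k + 1)
  | .stem k => 1 / 4 ^ (k + 1)
  | .triLoop k => 1 / (8 * 4 ^ k)
  | .quadLoop k => 1 / 4 ^ (k + 1)

/-- The weight system `w₁` on `T₁`. -/
noncomputable def w₁ : T₁.WeightSystem where
  weight := weight₁
  nonneg := by
    rintro (_ | _ | _ | _ | k | k | k | k | k) <;> simp only [weight₁] <;> positivity
  switch_condition := by
    rintro (_ | _ | _ | k | k | k) <;>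
      simp only [T₁, ends₁, weight₁, List.map_cons, List.map_nil, List.sum_cons, List.sum_nil] <;>
      field_simp <;> ring

/-- The class of the `n`-sheeted cyclic cover: going once around the bigon `e₁ ∪ e₂` changes the
sheet by one generator of `ZMod n`, and every other loop branch lifts to loops. -/
def shift (n : ℕ) : T₁.Branch → ZMod n
  | Branch₁.e₁ => 1
  | _ => 0

/-- The train track `Tₙ`. -/
def T (n : ℕ) : TrainTrack := T₁.cyclicCover n (shift n)

/-- The weight system `wₙ` on `Tₙ`. -/
noncomputable def w (n : ℕ) : (T n).WeightSystem := w₁.pullback n (shift n)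

end CoverTrack

/-! Fix a hand `κ`. If each rectangle is made half-open, containing the one horizontal side from
which the hand `κ` points into it, the half-open intervals at a switch tile both of its sides. The
leaves on the hand `κ` are then the orbits of an invertible map on directed segments, and
`mem_TP_iff` identifies the train paths with the itineraries of these orbits. This uses that every
switch has a single end on one of its sides and that all weights are positive.

For the given tracks the return map to the spine is self-similar. A leaf that goes down `spine k` at
height `h` (towards the bigon) comes back up at height `scale k - h`, on a path `block k z i`
depending only on the sheet `i` and on the zone `z` of `h` (`run_block`). A block of level `k + 1`
consists of four blocks of level `k`, one in each quarter of the heights of `spine k`, joined by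
turns around the loops at `quad k`, `tri k`, `quad k`. The cut points `1/3` and `2/3` of the zones
separate `e₁` from `e₂` on the way down and on the way back. They are fixed by the maps `x ↦ 1/4 +
x/4` and `x ↦ 1/2 + x/4` of the first and the last quarter visited, so the same four zones serve at
all levels.

Density: every block of an orbit lies in a block of the next level (`GoesDown.exists_succ`), and
these blocks exhaust the orbit, so each finite subpath of a train path lies in a block. In zone `a`
the first subblock is again in zone `a` and raises the sheet by one before another subblock of zone
`a` follows. Iteration reaches all `n` sheets, whence every block lies in every block of
sufficiently high level (`block_infix_block`), and every train path is dense.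

Half train paths: a ray fails to contain blocks of arbitrarily high level only if from some level on
its blocks are always the last of the four. The leaf then climbs the spine forever, which forces its
height on `spine 0` to be `1/3`, the sum of the series of terms `1/4^(k+1)`
(`eq_up_zero_of_escape`). This height is the singularity between `e₁` and `e₂`, so for each of the
`n` sheets the two hands give two leaves with different pasts, `2n` in total. Their escaping rays
never return to the branch passed just before `spine 0` and so are not dense. -/

namespace TrainTrack

theorem DirectedBranch.flip_flip {T : TrainTrack} (d : T.DirectedBranch) : d.flip.flip = d := by
  rcases d with ⟨b, _ | _⟩ <;> rfl

theorem _root_.Side.opp_opp (s : Side) : s.opp.opp = s := by cases s <;> rfl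

variable {T : TrainTrack}

namespace WeightSystem

/-! ## Half-open leaves -/

/-- The interval from `a` to `b`, containing its lower end if `u` holds and its upper end
otherwise. -/
def HalfOpen : Bool → ℝ → ℝ → ℝ → Prop
  | true, a, b, x => a ≤ x ∧ x < b
  | false, a, b, x => a < x ∧ x ≤ b

/-- Whether the given hand points upwards in a rectangle entered through the given end. -/
def upward : Hand → End → Bool
  | .left, .left => true
  | .left, .right => false
  | .right, .left => false
  | .right, .right => true

/-- Whether the given hand points upwards in `I(v)` on crossing `v` from the given side. -/
def crossUpward : Hand → Side → Bool
  | .left, .incoming => true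
  | .left, .outgoing => false
  | .right, .incoming => false
  | .right, .outgoing => true

/-- The total weight on one side of a switch. -/
def total (w : T.WeightSystem) (v : T.Switch) (s : Side) : ℝ :=
  ((T.ends v s).map fun e => w.weight e.1).sum

variable {w : T.WeightSystem}

theorem total_opp (v : T.Switch) (s : Side) : w.total v s.opp = w.total v s := by
  cases s
  · exact (w.switch_condition v).symm
  · exact w.switch_condition v

theorem sum_weight_nonneg (l : List (T.Branch × End)) :
    0 ≤ (l.map fun e => w.weight e.1).sum := by
  apply List.sum_nonneg
  intro x hx
  obtain ⟨e, -, rfl⟩ := List.mem_map.1 hx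
  exact w.nonneg _

theorem AttachedAt.nonneg {v : T.Switch} {s : Side} {e : T.Branch × End} {lo : ℝ}
    (h : w.AttachedAt v s e lo) : 0 ≤ lo := by
  obtain ⟨pre, post, -, rfl⟩ := h
  exact sum_weight_nonneg pre

theorem AttachedAt.add_le {v : T.Switch} {s : Side} {e : T.Branch × End} {lo : ℝ}
    (h : w.AttachedAt v s e lo) : lo + w.weight e.1 ≤ w.total v s := by
  obtain ⟨pre, post, h, rfl⟩ := h
  have := sum_weight_nonneg (w := w) post
  simp only [total, h, List.map_append, List.map_cons, List.sum_append, List.sum_cons]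
  linarith

theorem AttachedAt.mem {v : T.Switch} {s : Side} {e : T.Branch × End} {lo : ℝ}
    (h : w.AttachedAt v s e lo) : e ∈ T.ends v s := by
  obtain ⟨pre, post, h, -⟩ := h
  simp [h]

theorem AttachedAt.trichotomy {v : T.Switch} {s : Side} {e e' : T.Branch × End} {lo lo' : ℝ}
    (h : w.AttachedAt v s e lo) (h' : w.AttachedAt v s e' lo') :
    (e = e' ∧ lo = lo') ∨ lo + w.weight e.1 ≤ lo' ∨ lo' + w.weight e'.1 ≤ lo := by
  obtain ⟨pre, post, h, rfl⟩ := h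
  obtain ⟨pre', post', h', rfl⟩ := h'
  rw [h] at h'
  rcases List.append_eq_append_iff.1 h' with ⟨l, rfl, hl⟩ | ⟨l, rfl, hl⟩
  · cases l with
    | nil => simp_all
    | cons a l =>
      obtain ⟨rfl, rfl⟩ := List.cons.inj hl
      have := sum_weight_nonneg (w := w) l
      refine Or.inr (Or.inl ?_)
      simp only [List.map_append, List.map_cons, List.sum_append, List.sum_cons]
      linarith
  · cases l with
    | nil => simp_all
    | cons a l =>
      obtain ⟨rfl, rfl⟩ := List.cons.inj hl
      have := sum_weight_nonneg (w := w) l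
      refine Or.inr (Or.inr ?_)
      simp only [List.map_append, List.map_cons, List.sum_append, List.sum_cons]
      linarith

theorem place_unique {e : T.Branch × End} {v v' : T.Switch} {s s' : Side}
    (h : e ∈ T.ends v s) (h' : e ∈ T.ends v' s') : v = v' ∧ s = s' := by
  have := (T.exists_unique e).unique (y₁ := (v, s)) (y₂ := (v', s')) h h'
  simpa using this

theorem AttachedAt.unique_lo {v : T.Switch} {s : Side} {e : T.Branch × End} {lo lo' : ℝ}
    (h : w.AttachedAt v s e lo) (h' : w.AttachedAt v s e lo') : lo = lo' := by
  obtain ⟨pre, post, h, rfl⟩ := h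
  obtain ⟨pre', post', h', rfl⟩ := h'
  have hn := T.ends_nodup v s
  rw [h] at h' hn
  rcases List.append_eq_append_iff.1 h' with ⟨l, rfl, hl⟩ | ⟨l, rfl, hl⟩
  · cases l with
    | nil => simp
    | cons a l =>
      obtain ⟨rfl, rfl⟩ := List.cons.inj hl
      simp [List.nodup_append] at hn
  · cases l with
    | nil => simp
    | cons a l =>
      obtain ⟨rfl, rfl⟩ := List.cons.inj hl
      simp_all [List.nodup_append]

theorem GluedTo.unique {e : T.Branch × End} {h x x' : ℝ} {v v' : T.Switch} {s s' : Side}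
    (H : w.GluedTo e h v s x) (H' : w.GluedTo e h v' s' x') : v = v' ∧ s = s' ∧ x = x' := by
  obtain ⟨lo, ha, rfl⟩ := H
  obtain ⟨lo', ha', rfl⟩ := H'
  obtain ⟨rfl, rfl⟩ := place_unique ha.mem ha'.mem
  obtain rfl := ha.unique_lo ha'
  exact ⟨rfl, rfl, rfl⟩

theorem exists_attachedAt (e : T.Branch × End) : ∃ v s lo, w.AttachedAt v s e lo := by
  obtain ⟨⟨v, s⟩, hv, -⟩ := T.exists_unique e
  obtain ⟨pre, post, h⟩ := List.append_of_mem hv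
  exact ⟨v, s, _, pre, post, h, rfl⟩

/-- Consecutive intervals that are half-open on the same side tile their union without gaps or
overlaps, even if some of them are empty. -/
theorem exists_halfOpen_of_list (u : Bool) (x : ℝ) (l : List (T.Branch × End)) (a : ℝ)
    (h : HalfOpen u a (a + (l.map fun e => w.weight e.1).sum) x) :
    ∃ pre e post, l = pre ++ e :: post ∧
      HalfOpen u (a + (pre.map fun e => w.weight e.1).sum)
        (a + (pre.map fun e => w.weight e.1).sum + w.weight e.1) x := by
  induction l generalizing a with
  | nil => cases u <;> simp [HalfOpen] at h <;> exfalso <;> linarith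
  | cons e l ih =>
    by_cases hx : HalfOpen u a (a + w.weight e.1) x
    · exact ⟨[], e, l, rfl, by simpa using hx⟩
    · obtain ⟨pre, e', post, rfl, hp⟩ := ih (a + w.weight e.1) (by
        simp only [List.map_cons, List.sum_cons] at h
        cases u <;> simp only [HalfOpen, not_and, not_le, not_lt] at h hx ⊢ <;>
          exact ⟨hx h.1, by linarith⟩)
      refine ⟨e :: pre, e', post, rfl, ?_⟩
      simpa [add_assoc] using hp

theorem exists_attachedAt_halfOpen {u : Bool} {x : ℝ} {v : T.Switch} {s : Side}
    (h : HalfOpen u 0 (w.total v s) x) :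
    ∃ e lo, w.AttachedAt v s e lo ∧ HalfOpen u lo (lo + w.weight e.1) x := by
  obtain ⟨pre, e, post, hl, hp⟩ := exists_halfOpen_of_list (w := w) u x (T.ends v s) 0
    (by simpa [total] using h)
  exact ⟨e, _, ⟨pre, post, hl, rfl⟩, by simpa using hp⟩

/-- A translation preserves the upward direction and a rotation by `π` reverses it. The gluing
respects orientation, so the included side of a rectangle, determined by the hand, goes to the
included side of the interval in `I(v)`. -/
theorem halfOpen_start_iff (κ : Hand) (s : Side) (e : T.Branch × End) (h lo : ℝ) :
    HalfOpen (upward κ e.2) 0 (w.weight e.1) h ↔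
      HalfOpen (crossUpward κ s.opp) lo (lo + w.weight e.1) (lo + w.glue s e h) := by
  rcases e with ⟨b, _ | _⟩ <;> cases s <;> cases κ <;>
    simp only [upward, crossUpward, HalfOpen, Side.opp, glue] <;>
    constructor <;> rintro ⟨h₁, h₂⟩ <;> constructor <;> linarith

theorem halfOpen_end_iff (κ : Hand) (s : Side) (e : T.Branch × End) (h lo : ℝ) :
    HalfOpen (upward κ e.2.opp) 0 (w.weight e.1) h ↔
      HalfOpen (crossUpward κ s) lo (lo + w.weight e.1) (lo + w.glue s e h) := by
  rcases e with ⟨b, _ | _⟩ <;> cases s <;> cases κ <;>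
    simp only [upward, crossUpward, HalfOpen, glue, End.opp] <;>
    constructor <;> rintro ⟨h₁, h₂⟩ <;> constructor <;> linarith

theorem glue_mem_Ioo_iff (s : Side) (e : T.Branch × End) (h lo : ℝ) :
    h ∈ Set.Ioo 0 (w.weight e.1) ↔ lo + w.glue s e h ∈ Set.Ioo lo (lo + w.weight e.1) := by
  rcases e with ⟨b, _ | _⟩ <;> cases s <;> simp only [glue, Set.mem_Ioo] <;>
    constructor <;> rintro ⟨h₁, h₂⟩ <;> constructor <;> linarith

theorem glue_mem_Icc_iff (s : Side) (e : T.Branch × End) (h lo : ℝ) :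
    h ∈ Set.Icc 0 (w.weight e.1) ↔ lo + w.glue s e h ∈ Set.Icc lo (lo + w.weight e.1) := by
  rcases e with ⟨b, _ | _⟩ <;> cases s <;> simp only [glue, Set.mem_Icc] <;>
    constructor <;> rintro ⟨h₁, h₂⟩ <;> constructor <;> linarith

theorem glue_injective {s : Side} {e : T.Branch × End} {h h' : ℝ}
    (hh : w.glue s e h = w.glue s e h') : h = h' := by
  rcases e with ⟨b, _ | _⟩ <;> cases s <;> simp only [glue] at hh <;> linarith

theorem exists_glue_eq (s : Side) (e : T.Branch × End) (y : ℝ) : ∃ h, w.glue s e h = y := by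
  rcases e with ⟨b, _ | _⟩ <;> cases s
  · exact ⟨w.weight b - y, by simp [glue]⟩
  · exact ⟨y, rfl⟩
  · exact ⟨y, rfl⟩
  · exact ⟨w.weight b - y, by simp [glue]⟩

theorem HalfOpen.mem_Icc {u : Bool} {a b x : ℝ} (h : HalfOpen u a b x) : x ∈ Set.Icc a b := by
  cases u
  · exact ⟨h.1.le, h.2⟩
  · exact ⟨h.1, h.2.le⟩

theorem HalfOpen.mono {u : Bool} {a b a' b' x : ℝ} (h : HalfOpen u a b x) (ha : a' ≤ a)
    (hb : b ≤ b') : HalfOpen u a' b' x := by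
  cases u <;> exact ⟨by linarith [h.1], by linarith [h.2]⟩

variable (w) in
/-- The height lies in the rectangle, and so do the nearby heights on the hand `κ`. -/
def Inside (κ : Hand) (S : T.DirectedBranch × ℝ) : Prop :=
  HalfOpen (upward κ S.1.2) 0 (w.weight S.1.1) S.2

variable (w) in
/-- The leaf on the hand `κ` passes from the directed segment `S` to the directed segment `S'`. -/
def Step (κ : Hand) (S S' : T.DirectedBranch × ℝ) : Prop :=
  w.Inside κ S ∧ w.Inside κ S' ∧
    ∃ v s x, w.GluedTo S.1.flip S.2 v s x ∧ w.GluedTo S'.1 S'.2 v s.opp x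

theorem upward_opp (κ : Hand) (ε : End) : upward κ.opp ε.opp = upward κ ε := by
  cases κ <;> cases ε <;> rfl

/-- Reversing the direction of travel exchanges left and right. This gives the backward statements
below from the forward ones. -/
theorem Step.reverse {κ : Hand} {S S' : T.DirectedBranch × ℝ} (h : w.Step κ S S') :
    w.Step κ.opp (S'.1.flip, S'.2) (S.1.flip, S.2) := by
  obtain ⟨h₁, h₂, v, s, x, h₃, h₄⟩ := h
  refine ⟨?_, ?_, v, s.opp, x, ?_, ?_⟩
  · simpa only [Inside, DirectedBranch.flip, upward_opp] using h₂
  · simpa only [Inside, DirectedBranch.flip, upward_opp] using h₁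
  · simpa only [DirectedBranch.flip_flip] using h₄
  · simpa only [Side.opp_opp] using h₃

theorem _root_.TrainTrack.WeightSystem.Hand.opp_opp (κ : Hand) : κ.opp.opp = κ := by
  cases κ <;> rfl

theorem HalfOpen.eq_of_attachedAt {u : Bool} {x lo lo' : ℝ} {v : T.Switch} {s : Side}
    {e e' : T.Branch × End} (ha : w.AttachedAt v s e lo) (ha' : w.AttachedAt v s e' lo')
    (h : HalfOpen u lo (lo + w.weight e.1) x) (h' : HalfOpen u lo' (lo' + w.weight e'.1) x) :
    e = e' ∧ lo = lo' := by
  rcases ha.trichotomy ha' with H | H | H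
  · exact H
  · cases u <;> exfalso <;> linarith [h.1, h.2, h'.1, h'.2]
  · cases u <;> exfalso <;> linarith [h.1, h.2, h'.1, h'.2]

/-- Different half-open intervals on one side of a switch are disjoint, so the leaf has no choice at
a singularity. -/
theorem Step.right_unique {κ : Hand} {S S₁ S₂ : T.DirectedBranch × ℝ} (h₁ : w.Step κ S S₁)
    (h₂ : w.Step κ S S₂) : S₁ = S₂ := by
  obtain ⟨-, hi, v, s, x, hs, lo, ha, hx⟩ := h₁
  obtain ⟨-, hi', v', s', x', hs', lo', ha', hx'⟩ := h₂
  obtain ⟨rfl, rfl, rfl⟩ := hs.unique hs'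
  rw [Inside, halfOpen_start_iff κ s.opp _ _ lo, ← hx] at hi
  rw [Inside, halfOpen_start_iff κ s.opp _ _ lo', ← hx'] at hi'
  obtain ⟨he, rfl⟩ := hi.eq_of_attachedAt ha ha' hi'
  rw [hx, ← he, add_right_inj] at hx'
  exact Prod.ext he (glue_injective hx')

theorem Step.left_unique {κ : Hand} {S S₁ S₂ : T.DirectedBranch × ℝ} (h₁ : w.Step κ S₁ S)
    (h₂ : w.Step κ S₂ S) : S₁ = S₂ := by
  have := h₁.reverse.right_unique h₂.reverse
  simp only [Prod.mk.injEq] at this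
  refine Prod.ext ?_ this.2
  rw [← S₁.1.flip_flip, this.1, S₂.1.flip_flip]

/-- By the switch condition both sides of `v` tile the same half-open interval. -/
theorem exists_step {κ : Hand} {S : T.DirectedBranch × ℝ} (h : w.Inside κ S) :
    ∃ S', w.Step κ S S' := by
  obtain ⟨v, s, lo, ha⟩ := exists_attachedAt (w := w) S.1.flip
  have hx : HalfOpen (crossUpward κ s) lo (lo + w.weight S.1.1) (lo + w.glue s S.1.flip S.2) := by
    have := (halfOpen_end_iff (w := w) κ s S.1.flip S.2 lo).1
    refine this ?_
    rcases S with ⟨⟨b, _ | _⟩, y⟩ <;> exact h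
  obtain ⟨e, lo', ha', h'⟩ := exists_attachedAt_halfOpen (w := w) (v := v) (s := s.opp)
    (hx.mono ha.nonneg (by rw [total_opp]; exact ha.add_le))
  obtain ⟨y, hy⟩ := exists_glue_eq (w := w) s.opp e (lo + w.glue s S.1.flip S.2 - lo')
  have hx' : lo + w.glue s S.1.flip S.2 = lo' + w.glue s.opp e y := by linarith
  refine ⟨(e, y), h, ?_, v, s, _, ⟨lo, ha, rfl⟩, lo', ha', hx'⟩
  rw [Inside, halfOpen_start_iff κ s.opp _ _ lo', ← hx', Side.opp_opp]
  exact h'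

theorem exists_step_left {κ : Hand} {S : T.DirectedBranch × ℝ} (h : w.Inside κ S) :
    ∃ S', w.Step κ S' S := by
  obtain ⟨S', hS⟩ := exists_step (w := w) (κ := κ.opp) (S := (S.1.flip, S.2))
    (by simpa only [Inside, DirectedBranch.flip, upward_opp] using h)
  have := hS.reverse
  rw [Hand.opp_opp, DirectedBranch.flip_flip] at this
  exact ⟨_, this⟩

variable (w) in
/-- A bi-infinite sequence of segments followed by a leaf on the hand `κ`. -/
def IsOrbit (κ : Hand) (σ : ℤ → T.DirectedBranch × ℝ) : Prop :=
  ∀ i, w.Step κ (σ i) (σ (i + 1))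

theorem exists_isOrbit {κ : Hand} {S : T.DirectedBranch × ℝ} (h : w.Inside κ S) :
    ∃ σ, w.IsOrbit κ σ ∧ σ 0 = S := by
  have hr : ∀ S : {S // w.Inside κ S}, ∃ S' : {S // w.Inside κ S}, w.Step κ S.1 S'.1 := fun S =>
    let ⟨S', hS⟩ := exists_step S.2
    ⟨⟨S', hS.2.1⟩, hS⟩
  have hl : ∀ S : {S // w.Inside κ S}, ∃ S' : {S // w.Inside κ S}, w.Step κ S'.1 S.1 := fun S =>
    let ⟨S', hS⟩ := exists_step_left S.2
    ⟨⟨S', hS.1⟩, hS⟩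
  choose next hnext using hr
  choose prev hprev using hl
  -- `.negSucc k` is the index `-(k + 1)`, hence `k + 1` applications of `prev`.
  refine ⟨fun
    | .ofNat k => (next^[k] ⟨S, h⟩).1
    | .negSucc k => (prev^[k + 1] ⟨S, h⟩).1, ?_, rfl⟩
  rintro (k | _ | k)
  · change w.Step κ (next^[k] ⟨S, h⟩).1 (next^[k + 1] ⟨S, h⟩).1
    rw [Function.iterate_succ_apply']
    exact hnext _
  · exact hprev ⟨S, h⟩
  · change w.Step κ (prev^[k + 1 + 1] ⟨S, h⟩).1 (prev^[k + 1] ⟨S, h⟩).1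
    rw [Function.iterate_succ_apply' prev (k + 1)]
    exact hprev _

theorem IsOrbit.eq {κ : Hand} {σ σ' : ℤ → T.DirectedBranch × ℝ} (h : w.IsOrbit κ σ)
    (h' : w.IsOrbit κ σ') (h₀ : σ 0 = σ' 0) : σ = σ' := by
  funext i
  induction i using Int.induction_on with
  | zero => exact h₀
  | succ i ih => exact (h i).right_unique (ih ▸ h' i)
  | pred i ih =>
    have h₁ := h (-i - 1)
    have h₂ := h' (-i - 1)
    rw [sub_add_cancel] at h₁ h₂
    exact h₁.left_unique (ih ▸ h₂)

theorem IsOrbit.shift {κ : Hand} {σ : ℤ → T.DirectedBranch × ℝ} (h : w.IsOrbit κ σ) (c : ℤ) :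
    w.IsOrbit κ fun i => σ (i + c) := fun i => by
  have := h (i + c)
  rwa [add_right_comm] at this

end WeightSystem

end TrainTrack

/-! ### Leaves and orbits of half-open rectangles -/

namespace TrainTrack

variable {T : TrainTrack}

namespace WeightSystem

variable {w : T.WeightSystem}

theorem AttachedAt.meets {v : T.Switch} {s : Side} {e : T.Branch × End} {lo x : ℝ}
    (ha : w.AttachedAt v s e lo) (hx : x ∈ Set.Icc lo (lo + w.weight e.1)) : w.Meets e v x := by
  obtain ⟨h, hh⟩ := exists_glue_eq (w := w) s e (x - lo)
  have hx' : x = lo + w.glue s e h := by linarith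
  exact ⟨s, h, (glue_mem_Icc_iff s e h lo).2 (hx' ▸ hx), lo, ha, hx'⟩

theorem Meets.attachedAt {v : T.Switch} {e : T.Branch × End} {x : ℝ} (h : w.Meets e v x) :
    ∃ s lo, w.AttachedAt v s e lo ∧ x ∈ Set.Icc lo (lo + w.weight e.1) := by
  obtain ⟨s, h, hh, lo, ha, rfl⟩ := h
  exact ⟨s, lo, ha, (glue_mem_Icc_iff s e h lo).1 hh⟩

theorem AttachedAt.ne_of_opp {v : T.Switch} {s : Side} {e e' : T.Branch × End} {lo lo' : ℝ}
    (ha : w.AttachedAt v s e lo) (ha' : w.AttachedAt v s.opp e' lo') : e ≠ e' := by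
  rintro rfl
  have := (place_unique ha.mem ha'.mem).2
  cases s <;> simp [Side.opp] at this

/-- A point at the boundary of a rectangle end which is not an end point of `I(v)` is singular. -/
theorem isSingular_of_boundary {v : T.Switch} {s : Side} {e e' : T.Branch × End} {lo lo' x : ℝ}
    (ha : w.AttachedAt v s e lo) (ha' : w.AttachedAt v s.opp e' lo')
    (hx : x = lo ∨ x = lo + w.weight e.1) (hx' : x ∈ Set.Icc lo' (lo' + w.weight e'.1))
    (h₀ : 0 < x) (h₁ : x < w.total v s) : w.IsSingular v x := by
  have hw := w.nonneg e.1
  have hm : w.Meets e v x := ha.meets (by rcases hx with rfl | rfl <;> constructor <;> linarith)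
  suffices ∃ e'' lo'', w.AttachedAt v s e'' lo'' ∧ e'' ≠ e ∧
      x ∈ Set.Icc lo'' (lo'' + w.weight e''.1) by
    obtain ⟨e'', lo'', ha'', hne, hx''⟩ := this
    exact ⟨e, e', e'', ha.ne_of_opp ha', hne.symm, (ha''.ne_of_opp ha').symm, hm,
      ha'.meets hx', ha''.meets hx''⟩
  have hn := T.ends_nodup v s
  obtain ⟨pre, post, hl, rfl⟩ := ha
  rcases hx with rfl | rfl
  · rcases pre.eq_nil_or_concat with rfl | ⟨pre', e'', rfl⟩
    · simp at h₀
    · refine ⟨e'', _, ⟨pre', e :: post, by simp [hl], rfl⟩, ?_, ?_⟩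
      · rintro rfl
        simp [hl, List.nodup_append] at hn
      · have := w.nonneg e''.1
        simp only [List.map_append, List.map_cons, List.sum_append, List.sum_cons,
          List.concat_eq_append, List.map_nil, List.sum_nil]
        constructor <;> linarith
  · cases post with
    | nil => simp [total, hl] at h₁
    | cons e'' post =>
      refine ⟨e'', _, ⟨pre ++ [e], post, by simp [hl], rfl⟩, ?_, ?_⟩
      · rintro rfl
        simp [hl, List.nodup_append] at hn
      · have := w.nonneg e''.1
        simp only [List.map_append, List.map_cons, List.sum_append, List.sum_cons,
          List.map_nil, List.sum_nil]
        constructor <;> linarith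

theorem AttachedAt.of_singleton {v : T.Switch} {s : Side} {e e₀ : T.Branch × End} {lo : ℝ}
    (ha : w.AttachedAt v s e lo) (h : T.ends v s = [e₀]) :
    lo = 0 ∧ w.weight e.1 = w.total v s := by
  obtain ⟨pre, post, hl, rfl⟩ := ha
  rw [h] at hl
  have := List.singleton_eq_append_iff.1 hl
  simp at this
  obtain ⟨rfl, rfl, rfl⟩ := this
  simp [total, h]

theorem crossUpward_opp_opp (κ : Hand) (s : Side) :
    crossUpward κ.opp s.opp = crossUpward κ s := by
  cases κ <;> cases s <;> rfl

theorem LiesOn.halfOpen {k : Hand} {v : T.Switch} {s : Side} {x lo : ℝ} {e : T.Branch × End}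
    (h : w.LiesOn k v s x e) (ha : w.AttachedAt v s.opp e lo) (hw : 0 < w.weight e.1) :
    HalfOpen (crossUpward k s) lo (lo + w.weight e.1) x := by
  obtain ⟨lo', ha', h⟩ := h
  obtain rfl := ha.unique_lo ha'
  cases s <;> cases k <;> simp only at h <;> subst h <;>
    exact ⟨by linarith, by linarith⟩

theorem HalfOpen.liesOn {k : Hand} {v : T.Switch} {s : Side} {x lo : ℝ} {e : T.Branch × End}
    (h : HalfOpen (crossUpward k s) lo (lo + w.weight e.1) x) (ha : w.AttachedAt v s.opp e lo)
    (hx : x ∉ Set.Ioo lo (lo + w.weight e.1)) : w.LiesOn k v s x e := by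
  refine ⟨lo, ha, ?_⟩
  simp only [Set.mem_Ioo, not_and, not_lt] at hx
  cases s <;> cases k <;> simp only [crossUpward] at h ⊢
  · exact le_antisymm h.1 (not_lt.1 fun h' => absurd h.2 (not_lt.2 (hx h')))
  · exact le_antisymm (hx h.1) h.2
  · exact le_antisymm (hx h.1) h.2
  · exact le_antisymm h.1 (not_lt.1 fun h' => absurd h.2 (not_lt.2 (hx h')))

/-- If `x` were interior to an interval on each side, these two ends would be the only ones to meet
at `x`, whereas a singularity needs three. -/
theorem not_mem_Ioo_of_isSingular {v : T.Switch} {s : Side} {e e' : T.Branch × End}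
    {lo lo' x : ℝ} (ha : w.AttachedAt v s e lo) (ha' : w.AttachedAt v s.opp e' lo')
    (hs : w.IsSingular v x) (hx : x ∈ Set.Ioo lo (lo + w.weight e.1)) :
    x ∉ Set.Ioo lo' (lo' + w.weight e'.1) := by
  intro hx'
  have key : ∀ f, w.Meets f v x → f = e ∨ f = e' := by
    intro f hf
    obtain ⟨t, l, hl, hxl⟩ := hf.attachedAt
    have : t = s ∨ t = s.opp := by cases t <;> cases s <;> simp [Side.opp]
    rcases this with rfl | rfl
    · rcases hl.trichotomy ha with H | H | H
      · exact Or.inl H.1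
      · linarith [hx.1, hxl.2]
      · linarith [hx.2, hxl.1]
    · rcases hl.trichotomy ha' with H | H | H
      · exact Or.inr H.1
      · linarith [hx'.1, hxl.2]
      · linarith [hx'.2, hxl.1]
  obtain ⟨f₁, f₂, f₃, h₁₂, h₁₃, h₂₃, m₁, m₂, m₃⟩ := hs
  rcases key f₁ m₁ with rfl | rfl <;> rcases key f₂ m₂ with rfl | rfl <;>
    rcases key f₃ m₃ with rfl | rfl <;> contradiction

/-- The boundary side of a leaf is preserved on crossing a switch, and agrees with the hand chosen
for the leaf in the interiors of the rectangles. -/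
theorem halfOpen_crossing {v : T.Switch} (hv : ∃ s e, T.ends v s = [e]) (hpos : ∀ b, 0 < w.weight b)
    {s : Side} {e e' : T.Branch × End} {lo lo' x : ℝ} {k κ : Hand}
    (ha : w.AttachedAt v s e lo) (ha' : w.AttachedAt v s.opp e' lo')
    (hx' : x ∈ Set.Icc lo' (lo' + w.weight e'.1))
    (hk : x ∈ Set.Ioo lo (lo + w.weight e.1) → w.IsSingular v x → w.LiesOn k v s x e')
    (hk' : x ∈ Set.Ioo lo' (lo' + w.weight e'.1) → w.IsSingular v x →
      w.LiesOn k.opp v s.opp x e)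
    (h : HalfOpen (crossUpward κ s) lo (lo + w.weight e.1) x)
    (hκ : x ∈ Set.Ioo lo (lo + w.weight e.1) → κ = k) :
    HalfOpen (crossUpward κ s) lo' (lo' + w.weight e'.1) x ∧
      (x ∈ Set.Ioo lo' (lo' + w.weight e'.1) → κ = k) := by
  have hx := h.mem_Icc
  have ht := total_opp (w := w) v s
  have hp := hpos e.1
  have hp' := hpos e'.1
  obtain ⟨n₁, n₂, n₃, n₄⟩ : 0 ≤ lo ∧ 0 ≤ lo' ∧ lo + w.weight e.1 ≤ w.total v s ∧
      lo' + w.weight e'.1 ≤ w.total v s := ⟨ha.nonneg, ha'.nonneg, ha.add_le, ht ▸ ha'.add_le⟩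
  have hbd : ∀ {a b : ℝ}, x ∈ Set.Icc a b → x ∉ Set.Ioo a b → x = a ∨ x = b := by
    intro a b h₁ h₂
    rcases h₁.1.eq_or_lt with h | h
    · exact Or.inl h.symm
    · exact Or.inr (le_antisymm h₁.2 (not_lt.1 fun h' => h₂ ⟨h, h'⟩))
  obtain ⟨s₀, e₀, h₀⟩ := hv
  have : s₀ = s ∨ s₀ = s.opp := by cases s₀ <;> cases s <;> simp [Side.opp]
  rcases this with rfl | rfl
  -- The leaf comes from the single end. In its interior the forward condition on leaves decides
  -- which end follows; on its boundary `x` is an end point of `I(v)`, and the leaf remains on the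
  -- same boundary side.
  · obtain ⟨rfl, hw⟩ := ha.of_singleton h₀
    by_cases hi : x ∈ Set.Ioo 0 (0 + w.weight e.1)
    · obtain rfl := hκ hi
      refine ⟨?_, fun _ => rfl⟩
      by_cases hi' : x ∈ Set.Ioo lo' (lo' + w.weight e'.1)
      · cases h' : crossUpward κ s₀
        · exact ⟨hi'.1, hi'.2.le⟩
        · exact ⟨hi'.1.le, hi'.2⟩
      · have hs : w.IsSingular v x := isSingular_of_boundary (s := s₀.opp) ha'
          (by rw [Side.opp_opp]; exact ha) (hbd hx' hi') hx hi.1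
          (by rw [ht, ← hw]; simpa using hi.2)
        exact (hk hi hs).halfOpen ha' hp'
    · rcases hbd hx hi with hxe | hxe
      · have : lo' = 0 := le_antisymm (by linarith [hx'.1]) n₂
        refine ⟨?_, fun H => by linarith [H.1]⟩
        cases h' : crossUpward κ s₀ <;> rw [h'] at h
        · linarith [h.1]
        · exact ⟨by linarith, by linarith⟩
      · refine ⟨?_, fun H => by linarith [H.2]⟩
        cases h' : crossUpward κ s₀ <;> rw [h'] at h
        · exact ⟨by linarith [hx'.2], by linarith [hx'.2]⟩
        · linarith [h.2]
  -- The leaf enters the single end. If it passes from the boundary of `e` into the interior of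
  -- `e'`, the point is singular and the backward condition on leaves forces `κ = k`.
  · obtain ⟨rfl, hw⟩ := ha'.of_singleton h₀
    by_cases hi' : x ∈ Set.Ioo 0 (0 + w.weight e'.1)
    · have hκk : κ = k := by
        by_cases hi : x ∈ Set.Ioo lo (lo + w.weight e.1)
        · exact hκ hi
        · have hs := isSingular_of_boundary ha ha' (hbd hx hi) hx' hi'.1
            (by rw [← ht, ← hw]; simpa using hi'.2)
          have hh := (hk' hi' hs).halfOpen (by rw [Side.opp_opp]; exact ha) hp
          rw [crossUpward_opp_opp] at hh
          rcases hbd hx hi with hxe | hxe <;> subst hxe <;> cases κ <;> cases k <;> cases s <;>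
            first
            | rfl
            | (simp only [crossUpward] at h hh; exfalso; linarith [h.1, h.2, hh.1, hh.2])
      refine ⟨?_, fun _ => hκk⟩
      cases h' : crossUpward κ s
      · exact ⟨hi'.1, hi'.2.le⟩
      · exact ⟨hi'.1.le, hi'.2⟩
    · refine ⟨?_, fun H => absurd H hi'⟩
      rcases hbd hx' hi' with hxe | hxe
      · cases h' : crossUpward κ s <;> rw [h'] at h
        · linarith [h.1]
        · exact ⟨by linarith, by linarith⟩
      · cases h' : crossUpward κ s <;> rw [h'] at h
        · exact ⟨by linarith, by linarith⟩
        · linarith [h.2]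

theorem Segment.isInterior_iff_start {σ : w.Segment} {s : Side} {lo : ℝ} :
    σ.IsInterior ↔
      lo + w.glue s σ.dir σ.height ∈ Set.Ioo lo (lo + w.weight σ.dir.1) :=
  glue_mem_Ioo_iff s σ.dir σ.height lo

theorem Segment.isInterior_iff_end {σ : w.Segment} {s : Side} {lo : ℝ} :
    σ.IsInterior ↔
      lo + w.glue s σ.dir.flip σ.height ∈ Set.Ioo lo (lo + w.weight σ.dir.1) :=
  glue_mem_Ioo_iff s σ.dir.flip σ.height lo

theorem inside_iff_end (κ : Hand) (s : Side) (d : T.DirectedBranch) (h lo : ℝ) :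
    w.Inside κ (d, h) ↔
      HalfOpen (crossUpward κ s) lo (lo + w.weight d.1) (lo + w.glue s d.flip h) := by
  have := halfOpen_end_iff (w := w) κ s d.flip h lo
  rcases d with ⟨b, _ | _⟩ <;> exact this

theorem inside_iff_start (κ : Hand) (s : Side) (d : T.DirectedBranch) (h lo : ℝ) :
    w.Inside κ (d, h) ↔
      HalfOpen (crossUpward κ s) lo (lo + w.weight d.1) (lo + w.glue s.opp d h) := by
  have := halfOpen_start_iff (w := w) κ s.opp d h lo
  rwa [Side.opp_opp] at this

/-- In the interior of a rectangle both hands are possible and the one chosen for the leaf is taken;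
on the boundary the side determines the hand. -/
theorem exists_inside (hpos : ∀ b, 0 < w.weight b) (k : Hand) (σ : w.Segment) :
    ∃ κ, w.Inside κ (σ.dir, σ.height) ∧ (σ.IsInterior → κ = k) := by
  obtain ⟨h₁, h₂⟩ := σ.height_mem
  have hp := hpos σ.dir.1
  by_cases hi : σ.IsInterior
  · refine ⟨k, ?_, fun _ => rfl⟩
    unfold Inside
    cases upward k σ.dir.2
    · exact ⟨hi.1, hi.2.le⟩
    · exact ⟨hi.1.le, hi.2⟩
  · suffices ∃ κ, w.Inside κ (σ.dir, σ.height) from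
      let ⟨κ, h⟩ := this
      ⟨κ, h, fun h => absurd h hi⟩
    have hu : ∀ u, ∃ κ, upward κ σ.dir.2 = u := by
      intro u
      cases σ.dir.2 <;> cases u
      exacts [⟨.right, rfl⟩, ⟨.left, rfl⟩, ⟨.left, rfl⟩, ⟨.right, rfl⟩]
    rcases h₁.eq_or_lt with h | h
    · obtain ⟨κ, hκ⟩ := hu true
      refine ⟨κ, ?_⟩
      simp only [Inside, hκ]
      exact ⟨h₁, by linarith⟩
    · obtain ⟨κ, hκ⟩ := hu false
      refine ⟨κ, ?_⟩
      simp only [Inside, hκ]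
      exact ⟨h, h₂⟩

theorem inside_unique {κ κ' k : Hand} {σ : w.Segment}
    (h : w.Inside κ (σ.dir, σ.height) ∧ (σ.IsInterior → κ = k))
    (h' : w.Inside κ' (σ.dir, σ.height) ∧ (σ.IsInterior → κ' = k)) : κ = κ' := by
  by_cases hi : σ.IsInterior
  · rw [h.2 hi, h'.2 hi]
  · have h₁ := h.1
    have h₂ := h'.1
    simp only [Inside] at h₁ h₂
    simp only [Segment.IsInterior, Set.mem_Ioo, not_and, not_lt] at hi
    cases hd : σ.dir.2 <;> cases κ <;> cases κ' <;> simp only [hd, upward] at h₁ h₂ <;>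
      first
      | rfl
      | exact absurd h₁.2 (not_lt.2 (hi h₂.1))
      | exact absurd h₂.2 (not_lt.2 (hi h₁.1))

/-- The hand `κ` of the orbit may differ from the chosen hand `k` only for a leaf that never enters
the interior of a rectangle. The property `good κ` is carried forward by `halfOpen_crossing`; since
each segment admits exactly one good hand, it is also carried backward. -/
theorem IsLeaf.exists_isOrbit (hsw : ∀ v, ∃ s e, T.ends v s = [e]) (hpos : ∀ b, 0 < w.weight b)
    {σ : ℤ → w.Segment} (h : w.IsLeaf σ) :
    ∃ κ, w.IsOrbit κ fun i => ((σ i).dir, (σ i).height) := by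
  obtain ⟨hf, k, hk, hk'⟩ := h
  let good (κ : Hand) (i : ℤ) : Prop :=
    w.Inside κ ((σ i).dir, (σ i).height) ∧ ((σ i).IsInterior → κ = k)
  have step : ∀ κ i, good κ i → good κ (i + 1) := by
    rintro κ i ⟨h₁, h₂⟩
    obtain ⟨v, s, x, he, hs⟩ := hf i
    obtain ⟨lo, ha, hx⟩ := id he
    obtain ⟨lo', ha', hx'⟩ := id hs
    have h₁' := (inside_iff_end κ s _ _ lo).1 h₁
    have hi : (σ i).IsInterior ↔ x ∈ Set.Ioo lo (lo + w.weight (σ i).dir.1) := by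
      rw [hx]; exact Segment.isInterior_iff_end
    have hi' : (σ (i + 1)).IsInterior ↔ x ∈ Set.Ioo lo' (lo' + w.weight (σ (i + 1)).dir.1) := by
      rw [hx']; exact Segment.isInterior_iff_start
    have key := halfOpen_crossing (hsw v) hpos (κ := κ) (k := k) ha ha'
      (by rw [hx']; exact (glue_mem_Icc_iff _ _ _ lo').1 (σ (i + 1)).height_mem)
      (fun hxi hsing => hk i v s x (hi.2 hxi) he hsing)
      (fun hxi hsing => by
        have := hk' (i + 1) v s.opp x (hi'.2 hxi) hs hsing
        rwa [add_sub_cancel_right] at this)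
      (by rw [hx]; exact h₁') (fun hxi => h₂ (hi.2 hxi))
    refine ⟨?_, fun H => key.2 (hi'.1 H)⟩
    rw [inside_iff_start κ s _ _ lo', ← hx']
    exact key.1
  obtain ⟨κ, hκ⟩ := exists_inside hpos k (σ 0)
  have all : ∀ i, good κ i := by
    intro i
    induction i using Int.induction_on with
    | zero => exact hκ
    | succ i ih => exact step κ _ ih
    | pred i ih =>
      obtain ⟨κ', hκ'⟩ := exists_inside hpos k (σ (-i - 1))
      have := step κ' _ hκ'
      rw [sub_add_cancel] at this
      obtain rfl := inside_unique ih this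
      exact hκ'
  exact ⟨κ, fun i => ⟨(all i).1, (all (i + 1)).1, hf i⟩⟩

/-- An interior segment that meets a singularity continues along the boundary of the adjacent
rectangle, and half-openness says which boundary, hence on which hand that rectangle lies. -/
theorem IsOrbit.isLeaf {κ : Hand} {σ : ℤ → w.Segment}
    (h : w.IsOrbit κ fun i => ((σ i).dir, (σ i).height)) : w.IsLeaf σ := by
  refine ⟨fun i => (h i).2.2, κ, ?_, ?_⟩
  · intro i v s x hi he hs
    obtain ⟨-, h₂, v', s', x', he', hs'⟩ := h i
    obtain ⟨rfl, rfl, rfl⟩ := GluedTo.unique he he'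
    obtain ⟨lo, ha, hx⟩ := he
    obtain ⟨lo', ha', hx'⟩ := hs'
    rw [inside_iff_start κ s _ _ lo', ← hx'] at h₂
    rw [Segment.isInterior_iff_end (s := s) (lo := lo), ← hx] at hi
    exact h₂.liesOn ha' (not_mem_Ioo_of_isSingular ha ha' hs hi)
  · intro i v s x hi he hs
    have h' := h (i - 1)
    simp only [sub_add_cancel] at h'
    obtain ⟨h₁, -, v', s', x', he', hs'⟩ := h'
    obtain ⟨rfl, rfl, rfl⟩ := GluedTo.unique he hs'
    obtain ⟨lo, ha, hx⟩ := he
    obtain ⟨lo', ha', hx'⟩ := he'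
    rw [inside_iff_end κ s' _ _ lo', ← hx', ← crossUpward_opp_opp] at h₁
    rw [Segment.isInterior_iff_start (s := s'.opp) (lo := lo), ← hx] at hi
    rw [← Side.opp_opp s'] at ha'
    exact HalfOpen.liesOn (e := (σ (i - 1)).dir.flip) h₁ ha'
      (not_mem_Ioo_of_isSingular (e' := (σ (i - 1)).dir.flip) ha ha' hs hi)

/-- Train paths are the itineraries of leaves of half-open rectangles. -/
theorem mem_TP_iff (hsw : ∀ v, ∃ s e, T.ends v s = [e]) (hpos : ∀ b, 0 < w.weight b)
    {t : ℤ → T.DirectedBranch} :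
    t ∈ w.TP ↔ ∃ κ σ, w.IsOrbit κ σ ∧ ∀ i, t i = (σ i).1 := by
  constructor
  · rintro ⟨σ, hσ, ht⟩
    obtain ⟨κ, h⟩ := hσ.exists_isOrbit hsw hpos
    exact ⟨κ, _, h, ht⟩
  · rintro ⟨κ, σ, hσ, ht⟩
    exact ⟨fun i => ⟨(σ i).1, (σ i).2, HalfOpen.mem_Icc (hσ i).1⟩, IsOrbit.isLeaf hσ, ht⟩

end WeightSystem

end TrainTrack

/-! ### Finite pieces of orbits and attachment in cyclic covers -/

namespace TrainTrack.WeightSystem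

variable {T : TrainTrack} {w : T.WeightSystem}

variable (w) in
/-- The leaf on the hand `κ` passes from `S` to `S'`, reading off `l`, up to but excluding the
branch of `S'`. -/
inductive Run (κ : Hand) :
    T.DirectedBranch × ℝ → List T.DirectedBranch → T.DirectedBranch × ℝ → Prop
  | nil (S : T.DirectedBranch × ℝ) : Run κ S [] S
  | cons {S S₁ S₂ : T.DirectedBranch × ℝ} {l : List T.DirectedBranch} :
      w.Step κ S S₁ → Run κ S₁ l S₂ → Run κ S (S.1 :: l) S₂

theorem Run.append {κ : Hand} {S S₁ S₂ : T.DirectedBranch × ℝ} {l l' : List T.DirectedBranch}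
    (h : w.Run κ S l S₁) (h' : w.Run κ S₁ l' S₂) : w.Run κ S (l ++ l') S₂ := by
  induction h with
  | nil => exact h'
  | cons hs _ ih => exact .cons hs (ih h')

theorem IsOrbit.run_right {κ : Hand} {σ : ℤ → T.DirectedBranch × ℝ} (hσ : w.IsOrbit κ σ)
    {S S' : T.DirectedBranch × ℝ} {l : List T.DirectedBranch} (h : w.Run κ S l S') {i : ℤ}
    (hi : σ i = S) : σ (i + l.length) = S' ∧
      ∀ (j : ℕ) (hj : j < l.length), (σ (i + j)).1 = l[j] := by
  induction h generalizing i with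
  | nil => simpa using hi
  | cons hs _ ih =>
    subst hi
    obtain ⟨h₁, h₂⟩ := ih ((hσ i).right_unique hs)
    refine ⟨by rw [← h₁]; congr 1; push_cast [List.length_cons]; ring, ?_⟩
    rintro (_ | j) hj
    · simp
    · rw [List.getElem_cons_succ, ← h₂ j (by simpa using hj)]
      congr 2
      push_cast
      ring

/-- Steps are invertible, so an orbit that reaches the end of a run must have followed the run.
Blocks can therefore be located from their ends as well as from their starts. -/
theorem IsOrbit.run_left {κ : Hand} {σ : ℤ → T.DirectedBranch × ℝ} (hσ : w.IsOrbit κ σ)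
    {S S' : T.DirectedBranch × ℝ} {l : List T.DirectedBranch} (h : w.Run κ S l S') {i : ℤ}
    (hi : σ i = S') : σ (i - l.length) = S := by
  induction h generalizing i with
  | nil => simpa using hi
  | @cons S S₁ S₂ l hs _ ih =>
    have h₁ := hσ (i - l.length - 1)
    rw [sub_add_cancel, ih hi] at h₁
    rw [← h₁.left_unique hs]
    congr 1
    push_cast [List.length_cons]
    ring

theorem AttachedAt.pullback {v : T.Switch} {s : Side} {e : T.Branch × End} {lo : ℝ}
    (h : w.AttachedAt v s e lo) (n : ℕ) (c : T.Branch → ZMod n) (j : ZMod n) :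
    (w.pullback n c).AttachedAt (v, j) s (liftEnd c j e) lo := by
  obtain ⟨pre, post, h, rfl⟩ := h
  refine ⟨pre.map (liftEnd c j), post.map (liftEnd c j), ?_, ?_⟩
  · simp only [cyclicCover, h, List.map_append, List.map_cons]
    rfl
  · refine Eq.trans ?_ (congrArg List.sum (List.map_map ..).symm)
    refine congrArg List.sum (List.map_congr_left fun e' _ => ?_)
    exact (congrArg w.weight (liftEnd_fst c j e')).symm

end TrainTrack.WeightSystem

/-! ### Coordinates on the tracks `T n` -/

namespace CoverTrack

open TrainTrack WeightSystem

variable {n : ℕ}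

/-- The lift of a branch with a direction. -/
def lift (b : Branch₁) (i : ZMod n) (d : End) : (T n).DirectedBranch := ((b, i), d)

/-- The scale `4⁻ᵏ`. -/
noncomputable def scale (k : ℕ) : ℝ := 1 / 4 ^ k

theorem scale_pos (k : ℕ) : 0 < scale k := by unfold scale; positivity

@[simp] theorem scale_zero : scale 0 = 1 := by simp [scale]

theorem scale_succ (k : ℕ) : scale (k + 1) = scale k / 4 := by
  simp only [scale]; field_simp; ring

theorem weight₁_spine (k : ℕ) : weight₁ (.spine k) = scale k := rfl

theorem weight₁_mid (k : ℕ) : weight₁ (.mid k) = 3 / 4 * scale k := by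
  simp only [weight₁, scale]; field_simp; ring

theorem weight₁_stem (k : ℕ) : weight₁ (.stem k) = scale k / 4 := by
  simp only [weight₁, scale]; field_simp; ring

theorem weight₁_quadLoop (k : ℕ) : weight₁ (.quadLoop k) = scale k / 4 := by
  simp only [weight₁, scale]; field_simp; ring

theorem weight₁_triLoop (k : ℕ) : weight₁ (.triLoop k) = scale k / 8 := by
  simp only [weight₁, scale]; field_simp

/-- The lower end of the interval to which a branch end of `T₁` is attached. -/
noncomputable def lower : Branch₁ × End → ℝ
  | (.e₂, _) => 1 / 3
  | (.mainLoop, .right) => 1 / 2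
  | (.spine (k + 1), .right) => scale k / 4
  | (.stem k, .right) => 3 / 4 * scale k
  | (.triLoop k, .left) => scale k / 8
  | (.quadLoop k, .left) => scale k / 2
  | _ => 0

theorem attachedAt_lower (e : Branch₁ × End) :
    w₁.AttachedAt (place₁ e).1 (place₁ e).2 e (lower e) := by
  rcases e with ⟨_ | _ | _ | _ | (_ | k) | k | k | k | k, _ | _⟩
  case e₂.left => exact ⟨[(.e₁, .left)], [], rfl, by simp [lower, w₁, weight₁]⟩
  case e₂.right => exact ⟨[(.e₁, .right)], [], rfl, by simp [lower, w₁, weight₁]⟩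
  case mainLoop.right => exact ⟨[(.mainLoop, .left)], [], rfl, by simp [lower, w₁, weight₁]⟩
  case spine.succ.right =>
    exact ⟨[(.quadLoop k, .right)], [(.quadLoop k, .left)], rfl,
      by simp [lower, w₁, weight₁_quadLoop]⟩
  case stem.right =>
    exact ⟨[(.mid k, .right)], [], rfl, by simp [lower, w₁, weight₁_mid]⟩
  case triLoop.left =>
    exact ⟨[(.triLoop k, .right)], [], rfl, by simp [lower, w₁, weight₁_triLoop]⟩
  case quadLoop.left =>
    exact ⟨[(.quadLoop k, .right), (.spine (k + 1), .right)], [], rfl, by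
      simp [lower, w₁, weight₁_quadLoop, weight₁_spine, scale_succ]; ring⟩
  all_goals exact ⟨[], _, rfl, rfl⟩

/-- The sheet of the switch at an end of the lift of a branch. -/
def sheet (e : Branch₁ × End) (i : ZMod n) : ZMod n :=
  match e with
  | (_, .left) => i
  | (b, .right) => i + shift n b

theorem attachedAt_lift (e : Branch₁ × End) (i : ZMod n) :
    (w n).AttachedAt ((place₁ e).1, sheet e i) (place₁ e).2 (lift e.1 i e.2) (lower e) := by
  have hl : liftEnd (B := T₁.Branch) (shift n) (sheet e i) e = lift e.1 i e.2 := by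
    rcases e with ⟨b, _ | _⟩
    · rfl
    · exact congrArg (fun j => ((b, j), End.right)) (add_sub_cancel_right i (shift n b))
  have := (attachedAt_lower e).pullback n (shift n) (sheet e i)
  rwa [hl] at this

/-- Reduces a passage to data on `T₁`: `hp` and `hp'` say that the two ends lie on opposite sides of
one switch, `hj` compares the sheets, and `hx` compares the points of `I(v)`. -/
theorem step_of {κ : Hand} {b b' : Branch₁} {i i' : ZMod n} {d d' : End} {h h' : ℝ} {v : Switch₁}
    {s : Side} (hp : place₁ (b, d.opp) = (v, s)) (hp' : place₁ (b', d') = (v, s.opp))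
    (hj : sheet (b, d.opp) i = sheet (b', d') i')
    (hx : lower (b, d.opp) + w₁.glue s (b, d.opp) h = lower (b', d') + w₁.glue s.opp (b', d') h')
    (hi : HalfOpen (upward κ d) 0 (weight₁ b) h) (hi' : HalfOpen (upward κ d') 0 (weight₁ b') h') :
    (w n).Step κ (lift b i d, h) (lift b' i' d', h') := by
  have hg : ∀ (s : Side) (b : Branch₁) (i : ZMod n) (d : End) (h : ℝ),
      (w n).glue s (lift b i d) h = w₁.glue s (b, d) h := by
    intro s b i d h
    cases s <;> cases d <;> rfl
  have h₁ := attachedAt_lift (b, d.opp) i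
  have h₂ := attachedAt_lift (b', d') i'
  rw [hp] at h₁
  rw [hp', ← hj] at h₂
  refine ⟨hi, hi', _, s, _, ⟨_, h₁, rfl⟩, ⟨_, h₂, ?_⟩⟩
  rw [hg, ← hx]
  exact congrArg _ (hg s b i d.opp h)

theorem ends_singleton (v : (T n).Switch) : ∃ s e, (T n).ends v s = [e] := by
  obtain ⟨v, j⟩ := v
  have : ∃ s e, T₁.ends v s = [e] := by
    rcases v with _ | _ | _ | k | k | k
    exacts [⟨.incoming, _, rfl⟩, ⟨.outgoing, _, rfl⟩, ⟨.incoming, _, rfl⟩, ⟨.outgoing, _, rfl⟩,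
      ⟨.outgoing, _, rfl⟩, ⟨.outgoing, _, rfl⟩]
  obtain ⟨s, e, h⟩ := this
  refine ⟨s, liftEnd (shift n) j e, ?_⟩
  change (T₁.ends v s).map (liftEnd (shift n) j) = _
  rw [h]
  rfl

theorem weight_pos (b : (T n).Branch) : 0 < (w n).weight b := by
  obtain ⟨b, i⟩ := b
  change 0 < weight₁ b
  rcases b with _ | _ | _ | _ | k | k | k | k | k <;> simp only [weight₁] <;> positivity

/-! ## Elementary passages -/

section Passages

set_option linter.unusedSimpArgs false
set_option linter.unusedTactic false

variable {κ : Hand} {i : ZMod n} {h : ℝ} {k : ℕ}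

/-- In this and the following passages the hypothesis `H` places the height in the part of the
rectangle glued to the next one. A height is reflected when both ends are of the same kind on one
side of the loop's switch, and translated otherwise; the orientation of the loops at `base`, `quad
k` and `tri k` is what produces the reflections. -/
theorem step_spine_zero_e₁ (H : HalfOpen (upward κ .left) 0 (1 / 3) h) :
    (w n).Step κ (lift (.spine 0) i .left, h) (lift .e₁ i .left, h) := by
  apply step_of (v := .bigonLeft) (s := .incoming)
  · rfl
  · rfl
  · simp [sheet, shift, End.opp]
  all_goals
    cases κ <;> simp only [upward, HalfOpen, End.opp, Side.opp, lower, glue, w₁, weight₁_spine,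
      weight₁_mid, weight₁_stem, weight₁_triLoop, weight₁_quadLoop, scale_succ, scale_zero] at H ⊢ <;>
      norm_num [weight₁] at H ⊢ <;> first | linarith | (constructor <;> linarith)

theorem step_spine_zero_e₂ (H : HalfOpen (upward κ .left) (1 / 3) 1 h) :
    (w n).Step κ (lift (.spine 0) i .left, h) (lift .e₂ i .left, h - 1 / 3) := by
  apply step_of (v := .bigonLeft) (s := .incoming)
  · rfl
  · rfl
  · simp [sheet, shift, End.opp]
  all_goals
    cases κ <;> simp only [upward, HalfOpen, End.opp, Side.opp, lower, glue, w₁, weight₁_spine,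
      weight₁_mid, weight₁_stem, weight₁_triLoop, weight₁_quadLoop, scale_succ, scale_zero] at H ⊢ <;>
      norm_num [weight₁] at H ⊢ <;> first | linarith | (constructor <;> linarith)

theorem step_e₁_main (H : HalfOpen (upward κ .left) 0 (1 / 3) h) :
    (w n).Step κ (lift .e₁ i .left, h) (lift .main (i + 1) .left, h) := by
  apply step_of (v := .bigonRight) (s := .incoming)
  · rfl
  · rfl
  · simp [sheet, shift, End.opp]
  all_goals
    cases κ <;> simp only [upward, HalfOpen, End.opp, Side.opp, lower, glue, w₁, weight₁_spine,
      weight₁_mid, weight₁_stem, weight₁_triLoop, weight₁_quadLoop, scale_succ, scale_zero] at H ⊢ <;>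
      norm_num [weight₁] at H ⊢ <;> first | linarith | (constructor <;> linarith)

theorem step_e₂_main (H : HalfOpen (upward κ .left) 0 (2 / 3) h) :
    (w n).Step κ (lift .e₂ i .left, h) (lift .main i .left, h + 1 / 3) := by
  apply step_of (v := .bigonRight) (s := .incoming)
  · rfl
  · rfl
  · simp [sheet, shift, End.opp]
  all_goals
    cases κ <;> simp only [upward, HalfOpen, End.opp, Side.opp, lower, glue, w₁, weight₁_spine,
      weight₁_mid, weight₁_stem, weight₁_triLoop, weight₁_quadLoop, scale_succ, scale_zero] at H ⊢ <;>
      norm_num [weight₁] at H ⊢ <;> first | linarith | (constructor <;> linarith)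

theorem step_main_mainLoop_left (H : HalfOpen (upward κ .left) 0 (1 / 2) h) :
    (w n).Step κ (lift .main i .left, h) (lift .mainLoop i .left, h) := by
  apply step_of (v := .base) (s := .incoming)
  · rfl
  · rfl
  · simp [sheet, shift, End.opp]
  all_goals
    cases κ <;> simp only [upward, HalfOpen, End.opp, Side.opp, lower, glue, w₁, weight₁_spine,
      weight₁_mid, weight₁_stem, weight₁_triLoop, weight₁_quadLoop, scale_succ, scale_zero] at H ⊢ <;>
      norm_num [weight₁] at H ⊢ <;> first | linarith | (constructor <;> linarith)

theorem step_main_mainLoop_right (H : HalfOpen (upward κ .left) (1 / 2) 1 h) :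
    (w n).Step κ (lift .main i .left, h) (lift .mainLoop i .right, 1 - h) := by
  apply step_of (v := .base) (s := .incoming)
  · rfl
  · rfl
  · simp [sheet, shift, End.opp]
  all_goals
    cases κ <;> simp only [upward, HalfOpen, End.opp, Side.opp, lower, glue, w₁, weight₁_spine,
      weight₁_mid, weight₁_stem, weight₁_triLoop, weight₁_quadLoop, scale_succ, scale_zero] at H ⊢ <;>
      norm_num [weight₁] at H ⊢ <;> first | linarith | (constructor <;> linarith)

theorem step_mainLoop_left_main (H : HalfOpen (upward κ .left) 0 (1 / 2) h) :
    (w n).Step κ (lift .mainLoop i .left, h) (lift .main i .right, 1 - h) := by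
  apply step_of (v := .base) (s := .outgoing)
  · rfl
  · rfl
  · simp [sheet, shift, End.opp]
  all_goals
    cases κ <;> simp only [upward, HalfOpen, End.opp, Side.opp, lower, glue, w₁, weight₁_spine,
      weight₁_mid, weight₁_stem, weight₁_triLoop, weight₁_quadLoop, scale_succ, scale_zero] at H ⊢ <;>
      norm_num [weight₁] at H ⊢ <;> first | linarith | (constructor <;> linarith)

theorem step_mainLoop_right_main (H : HalfOpen (upward κ .right) 0 (1 / 2) h) :
    (w n).Step κ (lift .mainLoop i .right, h) (lift .main i .right, h) := by
  apply step_of (v := .base) (s := .outgoing)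
  · rfl
  · rfl
  · simp [sheet, shift, End.opp]
  all_goals
    cases κ <;> simp only [upward, HalfOpen, End.opp, Side.opp, lower, glue, w₁, weight₁_spine,
      weight₁_mid, weight₁_stem, weight₁_triLoop, weight₁_quadLoop, scale_succ, scale_zero] at H ⊢ <;>
      norm_num [weight₁] at H ⊢ <;> first | linarith | (constructor <;> linarith)

theorem step_main_e₁ (H : HalfOpen (upward κ .right) 0 (1 / 3) h) :
    (w n).Step κ (lift .main (i + 1) .right, h) (lift .e₁ i .right, h) := by
  apply step_of (v := .bigonRight) (s := .outgoing)
  · rfl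
  · rfl
  · simp [sheet, shift, End.opp]
  all_goals
    cases κ <;> simp only [upward, HalfOpen, End.opp, Side.opp, lower, glue, w₁, weight₁_spine,
      weight₁_mid, weight₁_stem, weight₁_triLoop, weight₁_quadLoop, scale_succ, scale_zero] at H ⊢ <;>
      norm_num [weight₁] at H ⊢ <;> first | linarith | (constructor <;> linarith)

theorem step_main_e₂ (H : HalfOpen (upward κ .right) (1 / 3) 1 h) :
    (w n).Step κ (lift .main i .right, h) (lift .e₂ i .right, h - 1 / 3) := by
  apply step_of (v := .bigonRight) (s := .outgoing)
  · rfl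
  · rfl
  · simp [sheet, shift, End.opp]
  all_goals
    cases κ <;> simp only [upward, HalfOpen, End.opp, Side.opp, lower, glue, w₁, weight₁_spine,
      weight₁_mid, weight₁_stem, weight₁_triLoop, weight₁_quadLoop, scale_succ, scale_zero] at H ⊢ <;>
      norm_num [weight₁] at H ⊢ <;> first | linarith | (constructor <;> linarith)

theorem step_e₁_spine_zero (H : HalfOpen (upward κ .right) 0 (1 / 3) h) :
    (w n).Step κ (lift .e₁ i .right, h) (lift (.spine 0) i .right, h) := by
  apply step_of (v := .bigonLeft) (s := .outgoing)
  · rfl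
  · rfl
  · simp [sheet, shift, End.opp]
  all_goals
    cases κ <;> simp only [upward, HalfOpen, End.opp, Side.opp, lower, glue, w₁, weight₁_spine,
      weight₁_mid, weight₁_stem, weight₁_triLoop, weight₁_quadLoop, scale_succ, scale_zero] at H ⊢ <;>
      norm_num [weight₁] at H ⊢ <;> first | linarith | (constructor <;> linarith)

theorem step_e₂_spine_zero (H : HalfOpen (upward κ .right) 0 (2 / 3) h) :
    (w n).Step κ (lift .e₂ i .right, h) (lift (.spine 0) i .right, h + 1 / 3) := by
  apply step_of (v := .bigonLeft) (s := .outgoing)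
  · rfl
  · rfl
  · simp [sheet, shift, End.opp]
  all_goals
    cases κ <;> simp only [upward, HalfOpen, End.opp, Side.opp, lower, glue, w₁, weight₁_spine,
      weight₁_mid, weight₁_stem, weight₁_triLoop, weight₁_quadLoop, scale_succ, scale_zero] at H ⊢ <;>
      norm_num [weight₁] at H ⊢ <;> first | linarith | (constructor <;> linarith)

theorem step_spine_succ_mid (H : HalfOpen (upward κ .left) 0 (scale k / 4) h) :
    (w n).Step κ (lift (.spine (k + 1)) i .left, h) (lift (.mid k) i .left, scale k / 4 + h) := by
  have := scale_pos k
  apply step_of (v := .quad k) (s := .incoming)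
  · rfl
  · rfl
  · simp [sheet, shift, End.opp]
  all_goals
    cases κ <;> simp only [upward, HalfOpen, End.opp, Side.opp, lower, glue, w₁, weight₁_spine,
      weight₁_mid, weight₁_stem, weight₁_triLoop, weight₁_quadLoop, scale_succ, scale_zero] at H ⊢ <;>
      norm_num [weight₁] at H ⊢ <;> first | linarith | (constructor <;> linarith)

theorem step_mid_spine (H : HalfOpen (upward κ .left) 0 (3 / 4 * scale k) h) :
    (w n).Step κ (lift (.mid k) i .left, h) (lift (.spine k) i .left, h) := by
  have := scale_pos k
  apply step_of (v := .split k) (s := .incoming)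
  · rfl
  · rfl
  · simp [sheet, shift, End.opp]
  all_goals
    cases κ <;> simp only [upward, HalfOpen, End.opp, Side.opp, lower, glue, w₁, weight₁_spine,
      weight₁_mid, weight₁_stem, weight₁_triLoop, weight₁_quadLoop, scale_succ, scale_zero] at H ⊢ <;>
      norm_num [weight₁] at H ⊢ <;> first | linarith | (constructor <;> linarith)

theorem step_spine_mid (H : HalfOpen (upward κ .right) 0 (3 / 4 * scale k) h) :
    (w n).Step κ (lift (.spine k) i .right, h) (lift (.mid k) i .right, h) := by
  have := scale_pos k
  apply step_of (v := .split k) (s := .outgoing)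
  · rfl
  · rfl
  · simp [sheet, shift, End.opp]
  all_goals
    cases κ <;> simp only [upward, HalfOpen, End.opp, Side.opp, lower, glue, w₁, weight₁_spine,
      weight₁_mid, weight₁_stem, weight₁_triLoop, weight₁_quadLoop, scale_succ, scale_zero] at H ⊢ <;>
      norm_num [weight₁] at H ⊢ <;> first | linarith | (constructor <;> linarith)

theorem step_mid_quadLoop_left (H : HalfOpen (upward κ .right) (scale k / 2) (3 / 4 * scale k) h) :
    (w n).Step κ (lift (.mid k) i .right, h) (lift (.quadLoop k) i .left, 3 / 4 * scale k - h) := by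
  have := scale_pos k
  apply step_of (v := .quad k) (s := .outgoing)
  · rfl
  · rfl
  · simp [sheet, shift, End.opp]
  all_goals
    cases κ <;> simp only [upward, HalfOpen, End.opp, Side.opp, lower, glue, w₁, weight₁_spine,
      weight₁_mid, weight₁_stem, weight₁_triLoop, weight₁_quadLoop, scale_succ, scale_zero] at H ⊢ <;>
      norm_num [weight₁] at H ⊢ <;> first | linarith | (constructor <;> linarith)

theorem step_quadLoop_left_mid (H : HalfOpen (upward κ .left) 0 (scale k / 4) h) :
    (w n).Step κ (lift (.quadLoop k) i .left, h) (lift (.mid k) i .left, h) := by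
  have := scale_pos k
  apply step_of (v := .quad k) (s := .incoming)
  · rfl
  · rfl
  · simp [sheet, shift, End.opp]
  all_goals
    cases κ <;> simp only [upward, HalfOpen, End.opp, Side.opp, lower, glue, w₁, weight₁_spine,
      weight₁_mid, weight₁_stem, weight₁_triLoop, weight₁_quadLoop, scale_succ, scale_zero] at H ⊢ <;>
      norm_num [weight₁] at H ⊢ <;> first | linarith | (constructor <;> linarith)

theorem step_mid_quadLoop_right (H : HalfOpen (upward κ .right) 0 (scale k / 4) h) :
    (w n).Step κ (lift (.mid k) i .right, h) (lift (.quadLoop k) i .right, h) := by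
  have := scale_pos k
  apply step_of (v := .quad k) (s := .outgoing)
  · rfl
  · rfl
  · simp [sheet, shift, End.opp]
  all_goals
    cases κ <;> simp only [upward, HalfOpen, End.opp, Side.opp, lower, glue, w₁, weight₁_spine,
      weight₁_mid, weight₁_stem, weight₁_triLoop, weight₁_quadLoop, scale_succ, scale_zero] at H ⊢ <;>
      norm_num [weight₁] at H ⊢ <;> first | linarith | (constructor <;> linarith)

theorem step_quadLoop_right_mid (H : HalfOpen (upward κ .right) 0 (scale k / 4) h) :
    (w n).Step κ (lift (.quadLoop k) i .right, h) (lift (.mid k) i .left, 3 / 4 * scale k - h) := by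
  have := scale_pos k
  apply step_of (v := .quad k) (s := .incoming)
  · rfl
  · rfl
  · simp [sheet, shift, End.opp]
  all_goals
    cases κ <;> simp only [upward, HalfOpen, End.opp, Side.opp, lower, glue, w₁, weight₁_spine,
      weight₁_mid, weight₁_stem, weight₁_triLoop, weight₁_quadLoop, scale_succ, scale_zero] at H ⊢ <;>
      norm_num [weight₁] at H ⊢ <;> first | linarith | (constructor <;> linarith)

theorem step_mid_spine_succ (H : HalfOpen (upward κ .right) (scale k / 4) (scale k / 2) h) :
    (w n).Step κ (lift (.mid k) i .right, h) (lift (.spine (k + 1)) i .right, h - scale k / 4) := by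
  have := scale_pos k
  apply step_of (v := .quad k) (s := .outgoing)
  · rfl
  · rfl
  · simp [sheet, shift, End.opp]
  all_goals
    cases κ <;> simp only [upward, HalfOpen, End.opp, Side.opp, lower, glue, w₁, weight₁_spine,
      weight₁_mid, weight₁_stem, weight₁_triLoop, weight₁_quadLoop, scale_succ, scale_zero] at H ⊢ <;>
      norm_num [weight₁] at H ⊢ <;> first | linarith | (constructor <;> linarith)

theorem step_spine_stem (H : HalfOpen (upward κ .right) (3 / 4 * scale k) (scale k) h) :
    (w n).Step κ (lift (.spine k) i .right, h) (lift (.stem k) i .right, h - 3 / 4 * scale k) := by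
  have := scale_pos k
  apply step_of (v := .split k) (s := .outgoing)
  · rfl
  · rfl
  · simp [sheet, shift, End.opp]
  all_goals
    cases κ <;> simp only [upward, HalfOpen, End.opp, Side.opp, lower, glue, w₁, weight₁_spine,
      weight₁_mid, weight₁_stem, weight₁_triLoop, weight₁_quadLoop, scale_succ, scale_zero] at H ⊢ <;>
      norm_num [weight₁] at H ⊢ <;> first | linarith | (constructor <;> linarith)

theorem step_stem_triLoop_left (H : HalfOpen (upward κ .right) (scale k / 8) (scale k / 4) h) :
    (w n).Step κ (lift (.stem k) i .right, h) (lift (.triLoop k) i .left, scale k / 4 - h) := by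
  have := scale_pos k
  apply step_of (v := .tri k) (s := .outgoing)
  · rfl
  · rfl
  · simp [sheet, shift, End.opp]
  all_goals
    cases κ <;> simp only [upward, HalfOpen, End.opp, Side.opp, lower, glue, w₁, weight₁_spine,
      weight₁_mid, weight₁_stem, weight₁_triLoop, weight₁_quadLoop, scale_succ, scale_zero] at H ⊢ <;>
      norm_num [weight₁] at H ⊢ <;> first | linarith | (constructor <;> linarith)

theorem step_triLoop_left_stem (H : HalfOpen (upward κ .left) 0 (scale k / 8) h) :
    (w n).Step κ (lift (.triLoop k) i .left, h) (lift (.stem k) i .left, h) := by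
  have := scale_pos k
  apply step_of (v := .tri k) (s := .incoming)
  · rfl
  · rfl
  · simp [sheet, shift, End.opp]
  all_goals
    cases κ <;> simp only [upward, HalfOpen, End.opp, Side.opp, lower, glue, w₁, weight₁_spine,
      weight₁_mid, weight₁_stem, weight₁_triLoop, weight₁_quadLoop, scale_succ, scale_zero] at H ⊢ <;>
      norm_num [weight₁] at H ⊢ <;> first | linarith | (constructor <;> linarith)

theorem step_stem_triLoop_right (H : HalfOpen (upward κ .right) 0 (scale k / 8) h) :
    (w n).Step κ (lift (.stem k) i .right, h) (lift (.triLoop k) i .right, h) := by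
  have := scale_pos k
  apply step_of (v := .tri k) (s := .outgoing)
  · rfl
  · rfl
  · simp [sheet, shift, End.opp]
  all_goals
    cases κ <;> simp only [upward, HalfOpen, End.opp, Side.opp, lower, glue, w₁, weight₁_spine,
      weight₁_mid, weight₁_stem, weight₁_triLoop, weight₁_quadLoop, scale_succ, scale_zero] at H ⊢ <;>
      norm_num [weight₁] at H ⊢ <;> first | linarith | (constructor <;> linarith)

theorem step_triLoop_right_stem (H : HalfOpen (upward κ .right) 0 (scale k / 8) h) :
    (w n).Step κ (lift (.triLoop k) i .right, h) (lift (.stem k) i .left, scale k / 4 - h) := by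
  have := scale_pos k
  apply step_of (v := .tri k) (s := .incoming)
  · rfl
  · rfl
  · simp [sheet, shift, End.opp]
  all_goals
    cases κ <;> simp only [upward, HalfOpen, End.opp, Side.opp, lower, glue, w₁, weight₁_spine,
      weight₁_mid, weight₁_stem, weight₁_triLoop, weight₁_quadLoop, scale_succ, scale_zero] at H ⊢ <;>
      norm_num [weight₁] at H ⊢ <;> first | linarith | (constructor <;> linarith)

theorem step_stem_spine (H : HalfOpen (upward κ .left) 0 (scale k / 4) h) :
    (w n).Step κ (lift (.stem k) i .left, h) (lift (.spine k) i .left, 3 / 4 * scale k + h) := by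
  have := scale_pos k
  apply step_of (v := .split k) (s := .incoming)
  · rfl
  · rfl
  · simp [sheet, shift, End.opp]
  all_goals
    cases κ <;> simp only [upward, HalfOpen, End.opp, Side.opp, lower, glue, w₁, weight₁_spine,
      weight₁_mid, weight₁_stem, weight₁_triLoop, weight₁_quadLoop, scale_succ, scale_zero] at H ⊢ <;>
      norm_num [weight₁] at H ⊢ <;> first | linarith | (constructor <;> linarith)

end Passages
end CoverTrack

namespace CoverTrack

open TrainTrack WeightSystem

variable {n : ℕ}

/-! ## Blocks -/

/-- The four parts into which the interval of heights of a branch `spine k` is divided. -/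
inductive Zone
  | a
  | b
  | c
  | d

namespace Zone

/-- The lower end of a zone, as a fraction of the weight. -/
noncomputable def lo : Zone → ℝ
  | a => 0
  | b => 1 / 3
  | c => 1 / 2
  | d => 2 / 3

/-- The upper end of a zone, as a fraction of the weight. -/
noncomputable def hi : Zone → ℝ
  | a => 1 / 3
  | b => 1 / 2
  | c => 2 / 3
  | d => 1

/-- The change of the sheet along a block. -/
def net : Zone → ZMod n
  | a => 1
  | b => 0
  | c => 0
  | d => -1

/-- The zone of the first subblock. -/
def first : Zone → Zone
  | a => a
  | _ => b

/-- The zone of the last subblock. -/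
def last : Zone → Zone
  | d => d
  | _ => c

/-- The direction in which the loop at `tri k` is traversed. -/
def loopEnd : Zone → End
  | a => .left
  | b => .left
  | c => .right
  | d => .right

/-- The two middle subblocks, of zones `a` and `d`, contribute `1` and `-1` and cancel, so a block
has the same net shift at every level. -/
theorem net_eq (z : Zone) : (z.net : ZMod n) = z.first.net + z.last.net := by
  cases z <;> simp [net, first, last]

end Zone

/-- The path of a block through the bigon and around the loop of weight `1/2`. -/
def baseBlock (i : ZMod n) : Zone → List (T n).DirectedBranch
  | .a => [lift (.spine 0) i .left, lift .e₁ i .left, lift .main (i + 1) .left,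
      lift .mainLoop (i + 1) .left, lift .main (i + 1) .right, lift .e₂ (i + 1) .right]
  | .b => [lift (.spine 0) i .left, lift .e₂ i .left, lift .main i .left,
      lift .mainLoop i .left, lift .main i .right, lift .e₂ i .right]
  | .c => [lift (.spine 0) i .left, lift .e₂ i .left, lift .main i .left,
      lift .mainLoop i .right, lift .main i .right, lift .e₂ i .right]
  | .d => [lift (.spine 0) i .left, lift .e₂ i .left, lift .main i .left,
      lift .mainLoop i .right, lift .main i .right, lift .e₁ (i - 1) .right]

/-- From `spine (k + 1)` to `spine k`. -/
def descent (k : ℕ) (i : ZMod n) : List (T n).DirectedBranch :=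
  [lift (.spine (k + 1)) i .left, lift (.mid k) i .left]

/-- From `spine k` to `spine (k + 1)`. -/
def ascent (k : ℕ) (i : ZMod n) : List (T n).DirectedBranch :=
  [lift (.spine k) i .right, lift (.mid k) i .right]

/-- From `spine k` around the loop at `quad k` and back. -/
def quadTurn (k : ℕ) (i : ZMod n) (ε : End) : List (T n).DirectedBranch :=
  [lift (.spine k) i .right, lift (.mid k) i .right, lift (.quadLoop k) i ε,
    lift (.mid k) i .left]

/-- From `spine k` around the loop at `tri k` and back. -/
def triTurn (k : ℕ) (i : ZMod n) (ε : End) : List (T n).DirectedBranch :=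
  [lift (.spine k) i .right, lift (.stem k) i .right, lift (.triLoop k) i ε,
    lift (.stem k) i .left]

/-- The path of a leaf from a passage of `spine k`, in the given zone and on the given sheet, to
its next return to `spine k`. -/
def block : ℕ → Zone → ZMod n → List (T n).DirectedBranch
  | 0, z, i => baseBlock i z
  | k + 1, z, i =>
    descent k i ++ (block k z.first i ++ (quadTurn k (i + z.first.net) .left ++
      (block k .a (i + z.first.net) ++ (triTurn k (i + z.first.net + 1) z.loopEnd ++
        (block k .d (i + z.first.net + 1) ++ (quadTurn k (i + z.first.net) .right ++
          (block k z.last (i + z.first.net) ++ ascent k (i + z.net))))))))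

/-- The length of a block. -/
def blockLength : ℕ → ℕ
  | 0 => 6
  | k + 1 => 4 * blockLength k + 16

@[simp] theorem length_block (k : ℕ) (z : Zone) (i : ZMod n) :
    (block k z i).length = blockLength k := by
  induction k generalizing z i with
  | zero => cases z <;> rfl
  | succ k ih =>
    simp only [block, List.length_append, ih, descent, quadTurn, triTurn, ascent, blockLength,
      List.length_cons, List.length_nil]
    ring

section Runs

variable {κ : Hand} {i : ZMod n} {h : ℝ} {k : ℕ}

/-- The segment of `spine k` at the height `h`, directed towards the bigon. -/
def down (k : ℕ) (i : ZMod n) (h : ℝ) : (T n).DirectedBranch × ℝ := (lift (.spine k) i .left, h)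

/-- The segment of `spine k` at the height `h`, directed away from the bigon. -/
def up (k : ℕ) (i : ZMod n) (h : ℝ) : (T n).DirectedBranch × ℝ := (lift (.spine k) i .right, h)

theorem upward_right (κ : Hand) : upward κ .right = !upward κ .left := by cases κ <;> rfl

/-- A leaf returning along a branch runs at a reflected height, and the reflection exchanges the
included and the excluded end point. -/
theorem halfOpen_not {u : Bool} {a b x a' b' x' : ℝ} (H : HalfOpen u a b x) (c : ℝ)
    (hx : x' = c - x) (ha : a' ≤ c - b) (hb : c - a ≤ b') : HalfOpen (!u) a' b' x' := by
  cases u <;> exact ⟨by linarith [H.1, H.2], by linarith [H.1, H.2]⟩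

theorem halfOpen_add {u : Bool} {a b x a' b' x' : ℝ} (H : HalfOpen u a b x) (c : ℝ)
    (hx : x' = c + x) (ha : a' ≤ c + a) (hb : c + b ≤ b') : HalfOpen u a' b' x' := by
  cases u <;> exact ⟨by linarith [H.1, H.2], by linarith [H.1, H.2]⟩

theorem run_descent (H : HalfOpen (upward κ .left) 0 (scale k / 4) h) :
    (w n).Run κ (down (k + 1) i h) (descent k i) (down k i (scale k / 4 + h)) :=
  have := scale_pos k
  .cons (step_spine_succ_mid H) <|
    .cons (step_mid_spine (halfOpen_add H (scale k / 4) rfl (by linarith) (by linarith))) <|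
      .nil _

theorem run_quadTurn_left (H : HalfOpen (upward κ .left) 0 (scale k / 4) h) :
    (w n).Run κ (up k i (3 / 4 * scale k - h)) (quadTurn k i .left) (down k i h) := by
  have := scale_pos k
  have H' : HalfOpen (upward κ .right) (scale k / 2) (3 / 4 * scale k) (3 / 4 * scale k - h) := by
    rw [upward_right]
    exact halfOpen_not H (3 / 4 * scale k) rfl (by linarith) (by linarith)
  refine .cons (step_spine_mid (H'.mono (by linarith) le_rfl)) ?_
  refine .cons (step_mid_quadLoop_left H') ?_
  rw [sub_sub_cancel]
  exact .cons (step_quadLoop_left_mid H) <|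
    .cons (step_mid_spine (H.mono le_rfl (by linarith))) (.nil _)

theorem run_quadTurn_right (H : HalfOpen (upward κ .left) 0 (scale k / 4) h) :
    (w n).Run κ (up k i (scale k / 4 - h)) (quadTurn k i .right)
      (down k i (scale k / 2 + h)) := by
  have := scale_pos k
  have H' : HalfOpen (upward κ .right) 0 (scale k / 4) (scale k / 4 - h) := by
    rw [upward_right]
    exact halfOpen_not H (scale k / 4) rfl (by linarith) (by linarith)
  refine .cons (step_spine_mid (H'.mono le_rfl (by linarith))) ?_
  refine .cons (step_mid_quadLoop_right H') ?_
  refine .cons (step_quadLoop_right_mid H') ?_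
  rw [show 3 / 4 * scale k - (scale k / 4 - h) = scale k / 2 + h by ring]
  exact .cons (step_mid_spine (halfOpen_add H (scale k / 2) rfl (by linarith) (by linarith)))
    (.nil _)

theorem run_triTurn_left (H : HalfOpen (upward κ .left) 0 (scale k / 8) h) :
    (w n).Run κ (up k i (scale k - h)) (triTurn k i .left) (down k i (3 / 4 * scale k + h)) := by
  have := scale_pos k
  have H₁ : HalfOpen (upward κ .right) (3 / 4 * scale k) (scale k) (scale k - h) := by
    rw [upward_right]
    exact halfOpen_not H (scale k) rfl (by linarith) (by linarith)
  have H₂ : HalfOpen (upward κ .right) (scale k / 8) (scale k / 4)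
      (scale k - h - 3 / 4 * scale k) := by
    rw [upward_right]
    exact halfOpen_not H (scale k / 4) (by ring) (by linarith) (by linarith)
  refine .cons (step_spine_stem H₁) ?_
  refine .cons (step_stem_triLoop_left H₂) ?_
  rw [show scale k / 4 - (scale k - h - 3 / 4 * scale k) = h by ring]
  exact .cons (step_triLoop_left_stem H) <|
    .cons (step_stem_spine (H.mono le_rfl (by linarith))) (.nil _)

theorem run_triTurn_right (H : HalfOpen (upward κ .left) (scale k / 8) (scale k / 4) h) :
    (w n).Run κ (up k i (scale k - h)) (triTurn k i .right) (down k i (3 / 4 * scale k + h)) := by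
  have := scale_pos k
  have H₁ : HalfOpen (upward κ .right) (3 / 4 * scale k) (scale k) (scale k - h) := by
    rw [upward_right]
    exact halfOpen_not H (scale k) rfl (by linarith) (by linarith)
  have H₂ : HalfOpen (upward κ .right) 0 (scale k / 8) (scale k - h - 3 / 4 * scale k) := by
    rw [upward_right]
    exact halfOpen_not H (scale k / 4) (by ring) (by linarith) (by linarith)
  refine .cons (step_spine_stem H₁) ?_
  refine .cons (step_stem_triLoop_right H₂) ?_
  refine .cons (step_triLoop_right_stem H₂) ?_
  rw [show scale k / 4 - (scale k - h - 3 / 4 * scale k) = h by ring]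
  exact .cons (step_stem_spine (H.mono (by linarith) le_rfl)) (.nil _)

/-- The two directions around the loop at `tri k` are separated at `h = scale k / 8`, half the
weight of `spine (k + 1)`. This is the cut between the zones `b` and `c`, as for the loop of weight
`1/2` at level zero. -/
theorem run_triTurn {z : Zone}
    (H : HalfOpen (upward κ .left) (z.lo * (scale k / 4)) (z.hi * (scale k / 4)) h) :
    (w n).Run κ (up k i (scale k - h)) (triTurn k i z.loopEnd)
      (down k i (3 / 4 * scale k + h)) := by
  have := scale_pos k
  cases z <;> simp only [Zone.lo, Zone.hi] at H
  · exact run_triTurn_left (H.mono (by linarith) (by linarith))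
  · exact run_triTurn_left (H.mono (by linarith) (by linarith))
  · exact run_triTurn_right (H.mono (by linarith) (by linarith))
  · exact run_triTurn_right (H.mono (by linarith) (by linarith))

theorem run_ascent (H : HalfOpen (upward κ .left) 0 (scale k / 4) h) :
    (w n).Run κ (up k i (scale k / 2 - h)) (ascent k i) (up (k + 1) i (scale k / 4 - h)) := by
  have := scale_pos k
  have H' : HalfOpen (upward κ .right) (scale k / 4) (scale k / 2) (scale k / 2 - h) := by
    rw [upward_right]
    exact halfOpen_not H (scale k / 2) rfl (by linarith) (by linarith)
  refine .cons (step_spine_mid (H'.mono (by linarith) (by linarith))) ?_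
  rw [show scale k / 4 - h = scale k / 2 - h - scale k / 4 by ring]
  exact .cons (step_mid_spine_succ H') (.nil _)

theorem run_baseBlock {z : Zone} (H : HalfOpen (upward κ .left) z.lo z.hi h) :
    (w n).Run κ (down 0 i h) (baseBlock i z) (up 0 (i + z.net) (1 - h)) := by
  have hr : ∀ {a b : ℝ}, 1 - z.hi ≥ a → 1 - z.lo ≤ b →
      HalfOpen (upward κ .right) a b (1 - h) := by
    intro a b ha hb
    rw [upward_right]
    exact halfOpen_not H 1 rfl ha hb
  have hl : ∀ {a b : ℝ}, a ≤ z.lo → z.hi ≤ b → HalfOpen (upward κ .left) a b h := H.mono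
  cases z <;> simp only [Zone.lo, Zone.hi] at hr hl
  · refine .cons (step_spine_zero_e₁ (hl (by norm_num) (by norm_num))) <|
      .cons (step_e₁_main (hl (by norm_num) (by norm_num))) <|
      .cons (step_main_mainLoop_left (hl (by norm_num) (by norm_num))) <|
      .cons (step_mainLoop_left_main (hl (by norm_num) (by norm_num))) <|
      .cons (step_main_e₂ (hr (by norm_num) (by norm_num))) ?_
    have := step_e₂_spine_zero (κ := κ) (i := i + 1) (h := 1 - h - 1 / 3)
      (halfOpen_add (hr (a := 2 / 3) (b := 1) (by norm_num) (by norm_num)) (-(1 / 3))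
        (by ring) (by norm_num) (by norm_num))
    rw [sub_add_cancel] at this
    exact .cons this (.nil _)
  · refine .cons (step_spine_zero_e₂ (hl (by norm_num) (by norm_num))) ?_
    have h₁ := step_e₂_main (κ := κ) (i := i) (h := h - 1 / 3)
      (halfOpen_add H (-(1 / 3)) (by ring) (by norm_num [Zone.lo]) (by norm_num [Zone.hi]))
    rw [sub_add_cancel] at h₁
    refine .cons h₁ <|
      .cons (step_main_mainLoop_left (hl (by norm_num) (by norm_num))) <|
      .cons (step_mainLoop_left_main (hl (by norm_num) (by norm_num))) <|
      .cons (step_main_e₂ (hr (by norm_num) (by norm_num))) ?_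
    have := step_e₂_spine_zero (κ := κ) (i := i) (h := 1 - h - 1 / 3)
      (halfOpen_add (hr (a := 1 / 3) (b := 1) (by norm_num) (by norm_num)) (-(1 / 3))
        (by ring) (by norm_num) (by norm_num))
    rw [sub_add_cancel] at this
    rw [Zone.net, add_zero]
    exact .cons this (.nil _)
  · refine .cons (step_spine_zero_e₂ (hl (by norm_num) (by norm_num))) ?_
    have h₁ := step_e₂_main (κ := κ) (i := i) (h := h - 1 / 3)
      (halfOpen_add H (-(1 / 3)) (by ring) (by norm_num [Zone.lo]) (by norm_num [Zone.hi]))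
    rw [sub_add_cancel] at h₁
    refine .cons h₁ <|
      .cons (step_main_mainLoop_right (hl (by norm_num) (by norm_num))) <|
      .cons (step_mainLoop_right_main (hr (by norm_num) (by norm_num))) <|
      .cons (step_main_e₂ (hr (by norm_num) (by norm_num))) ?_
    have := step_e₂_spine_zero (κ := κ) (i := i) (h := 1 - h - 1 / 3)
      (halfOpen_add (hr (a := 1 / 3) (b := 1) (by norm_num) (by norm_num)) (-(1 / 3))
        (by ring) (by norm_num) (by norm_num))
    rw [sub_add_cancel] at this
    rw [Zone.net, add_zero]
    exact .cons this (.nil _)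
  · refine .cons (step_spine_zero_e₂ (hl (by norm_num) (by norm_num))) ?_
    have h₁ := step_e₂_main (κ := κ) (i := i) (h := h - 1 / 3)
      (halfOpen_add H (-(1 / 3)) (by ring) (by norm_num [Zone.lo]) (by norm_num [Zone.hi]))
    rw [sub_add_cancel] at h₁
    have h₂ := step_main_e₁ (κ := κ) (i := i - 1) (h := 1 - h) (hr (by norm_num) (by norm_num))
    rw [sub_add_cancel] at h₂
    refine .cons h₁ <|
      .cons (step_main_mainLoop_right (hl (by norm_num) (by norm_num))) <|
      .cons (step_mainLoop_right_main (hr (by norm_num) (by norm_num))) <|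
      .cons h₂ ?_
    rw [Zone.net, ← sub_eq_add_neg]
    exact .cons (step_e₁_spine_zero (hr (by norm_num) (by norm_num))) (.nil _)

/-- With `s = scale k`, a leaf going down `spine (k + 1)` at height `h` passes `spine k` downwards
at the heights `s/4 + h`, `h`, `3s/4 + h`, `s/2 + h`, and returns upwards at `s` minus each of them.
The second and third heights always lie in the zones `a` and `d`; the zones of the other two are
`z.first` and `z.last`. -/
theorem run_block {z : Zone}
    (H : HalfOpen (upward κ .left) (z.lo * scale k) (z.hi * scale k) h) :
    (w n).Run κ (down k i h) (block k z i) (up k (i + z.net) (scale k - h)) := by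
  induction k generalizing z i h with
  | zero =>
    simp only [scale_zero, mul_one] at H ⊢
    exact run_baseBlock H
  | succ k ih =>
    have hs := scale_pos k
    rw [scale_succ] at H ⊢
    have H₀ : HalfOpen (upward κ .left) 0 (scale k / 4) h :=
      H.mono (by cases z <;> simp only [Zone.lo] <;> linarith)
        (by cases z <;> simp only [Zone.hi] <;> linarith)
    refine (run_descent H₀).append ?_
    refine (ih (z := z.first) (halfOpen_add H (scale k / 4) rfl
      (by cases z <;> simp only [Zone.lo, Zone.first] <;> linarith)
      (by cases z <;> simp only [Zone.hi, Zone.first] <;> linarith))).append ?_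
    rw [show scale k - (scale k / 4 + h) = 3 / 4 * scale k - h by ring]
    refine (run_quadTurn_left H₀).append ?_
    refine (ih (z := .a) (H₀.mono (by simp [Zone.lo]) (by simp only [Zone.hi]; linarith))).append ?_
    rw [Zone.net]
    refine (run_triTurn H).append ?_
    refine (ih (z := .d) (halfOpen_add H₀ (3 / 4 * scale k) rfl (by simp only [Zone.lo]; linarith)
      (by simp only [Zone.hi]; linarith))).append ?_
    rw [show scale k - (3 / 4 * scale k + h) = scale k / 4 - h by ring, Zone.net,
      add_neg_cancel_right]
    refine (run_quadTurn_right H₀).append ?_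
    refine (ih (z := z.last) (halfOpen_add H (scale k / 2) rfl
      (by cases z <;> simp only [Zone.lo, Zone.last] <;> linarith)
      (by cases z <;> simp only [Zone.hi, Zone.last] <;> linarith))).append ?_
    rw [show scale k - (scale k / 2 + h) = scale k / 2 - h by ring, Zone.net_eq z, add_assoc]
    exact run_ascent H₀

end Runs

end CoverTrack

namespace CoverTrack

open TrainTrack WeightSystem

variable {n : ℕ} {κ : Hand} {σ : ℤ → (T n).DirectedBranch × ℝ}

/-! ## Blocks in orbits -/

theorem exists_zone {u : Bool} {q h : ℝ} (H : HalfOpen u 0 q h) :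
    ∃ z : Zone, HalfOpen u (z.lo * q) (z.hi * q) h := by
  cases u
  · rcases le_or_gt h (1 / 3 * q) with h₁ | h₁
    · exact ⟨.a, by simpa [Zone.lo] using H.1, h₁⟩
    rcases le_or_gt h (1 / 2 * q) with h₂ | h₂
    · exact ⟨.b, h₁, h₂⟩
    rcases le_or_gt h (2 / 3 * q) with h₃ | h₃
    · exact ⟨.c, h₂, h₃⟩
    · exact ⟨.d, h₃, by simpa [Zone.hi] using H.2⟩
  · rcases lt_or_ge h (1 / 3 * q) with h₁ | h₁
    · exact ⟨.a, by simpa [Zone.lo] using H.1, h₁⟩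
    rcases lt_or_ge h (1 / 2 * q) with h₂ | h₂
    · exact ⟨.b, h₁, h₂⟩
    rcases lt_or_ge h (2 / 3 * q) with h₃ | h₃
    · exact ⟨.c, h₂, h₃⟩
    · exact ⟨.d, h₃, by simpa [Zone.hi] using H.2⟩

theorem exists_quarter {u : Bool} {q h : ℝ} (H : HalfOpen u 0 q h) :
    HalfOpen u 0 (q / 4) h ∨ HalfOpen u 0 (q / 4) (h - q / 4) ∨
      HalfOpen u 0 (q / 4) (h - q / 2) ∨ HalfOpen u 0 (q / 4) (h - 3 / 4 * q) := by
  cases u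
  · rcases le_or_gt h (q / 4) with h₁ | h₁
    · exact .inl ⟨H.1, h₁⟩
    rcases le_or_gt h (q / 2) with h₂ | h₂
    · exact .inr (.inl ⟨by linarith, by linarith⟩)
    rcases le_or_gt h (3 / 4 * q) with h₃ | h₃
    · exact .inr (.inr (.inl ⟨by linarith, by linarith⟩))
    · exact .inr (.inr (.inr ⟨by linarith, by linarith [H.2]⟩))
  · rcases lt_or_ge h (q / 4) with h₁ | h₁
    · exact .inl ⟨H.1, h₁⟩
    rcases lt_or_ge h (q / 2) with h₂ | h₂
    · exact .inr (.inl ⟨by linarith, by linarith⟩)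
    rcases lt_or_ge h (3 / 4 * q) with h₃ | h₃
    · exact .inr (.inr (.inl ⟨by linarith, by linarith⟩))
    · exact .inr (.inr (.inr ⟨by linarith, by linarith [H.2]⟩))

theorem inside_down {k : ℕ} {i : ZMod n} {h : ℝ} (H : (w n).Inside κ (down k i h)) :
    HalfOpen (upward κ .left) 0 (scale k) h := H

theorem inside_up {k : ℕ} {i : ZMod n} {h : ℝ} (H : (w n).Inside κ (up k i h)) :
    HalfOpen (upward κ .right) 0 (scale k) h := H

/-- At the index `a`, the orbit passes `spine k` towards the bigon. -/
def GoesDown (σ : ℤ → (T n).DirectedBranch × ℝ) (k : ℕ) (a : ℤ) : Prop :=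
  ∃ i h, σ a = down k i h

/-- At the index `a`, the orbit passes `spine k` away from the bigon. -/
def GoesUp (σ : ℤ → (T n).DirectedBranch × ℝ) (k : ℕ) (a : ℤ) : Prop :=
  ∃ i h, σ a = up k i h

theorem GoesDown.exists_block (hσ : (w n).IsOrbit κ σ) {k : ℕ} {a : ℤ} (ha : GoesDown σ k a) :
    GoesUp σ k (a + blockLength k) ∧ ∃ z i, ∀ (j : ℕ) (hj : j < (block k z i).length),
      (σ (a + j)).1 = (block k z i : List (T n).DirectedBranch)[j] := by
  obtain ⟨i, h, ha⟩ := ha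
  have hi := (hσ a).1
  rw [ha] at hi
  obtain ⟨z, hz⟩ := exists_zone (inside_down hi)
  obtain ⟨h₁, h₂⟩ := hσ.run_right (run_block (i := i) hz) ha
  rw [length_block] at h₁
  exact ⟨⟨_, _, h₁⟩, z, i, h₂⟩

/-- The block starting at the reflected height ends at this segment; its length does not depend on
the zone, so its start is at a known index. -/
theorem GoesUp.goesDown (hσ : (w n).IsOrbit κ σ) {k : ℕ} {a : ℤ} (ha : GoesUp σ k a) :
    GoesDown σ k (a - blockLength k) := by
  obtain ⟨i, h, ha⟩ := ha
  have hi := (hσ a).1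
  rw [ha] at hi
  have hi := inside_up hi
  have hs : HalfOpen (upward κ .left) 0 (scale k) (scale k - h) := by
    rw [← Bool.not_not (upward κ .left), ← upward_right]
    exact halfOpen_not hi (scale k) rfl (by simp) (by simp)
  obtain ⟨z, hz⟩ := exists_zone hs
  have := run_block (i := i - z.net) hz
  rw [sub_sub_cancel, sub_add_cancel] at this
  have h₁ := hσ.run_left this ha
  rw [length_block] at h₁
  exact ⟨_, _, h₁⟩

/-- This lemma and the next two cut the block of level `k + 1` at the starts of its second, third
and fourth subblocks. -/
theorem run_second {k : ℕ} {i : ZMod n} {h : ℝ} {z : Zone}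
    (H : HalfOpen (upward κ .left) 0 (scale k / 4) h)
    (hz : HalfOpen (upward κ .left) (z.lo * (scale k / 4)) (z.hi * (scale k / 4)) h) :
    (w n).Run κ (down (k + 1) i h)
      (descent k i ++ (block k z.first i ++ quadTurn k (i + z.first.net) .left))
      (down k (i + z.first.net) h) := by
  refine (run_descent H).append ((run_block (z := z.first) (halfOpen_add hz (scale k / 4) rfl
    (by cases z <;> simp only [Zone.lo, Zone.first] <;> linarith [scale_pos k])
    (by cases z <;> simp only [Zone.hi, Zone.first] <;> linarith [scale_pos k]))).append ?_)
  rw [show scale k - (scale k / 4 + h) = 3 / 4 * scale k - h by ring]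
  exact run_quadTurn_left H

theorem run_third {k : ℕ} {i : ZMod n} {h : ℝ} {z : Zone}
    (H : HalfOpen (upward κ .left) 0 (scale k / 4) h)
    (hz : HalfOpen (upward κ .left) (z.lo * (scale k / 4)) (z.hi * (scale k / 4)) h) :
    (w n).Run κ (down k i h) (block k .a i ++ triTurn k (i + 1) z.loopEnd)
      (down k (i + 1) (3 / 4 * scale k + h)) :=
  (run_block (z := .a) (H.mono (by simp [Zone.lo])
    (by simp only [Zone.hi]; linarith [scale_pos k]))).append (run_triTurn hz)

theorem run_fourth {k : ℕ} {i : ZMod n} {h : ℝ}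
    (H : HalfOpen (upward κ .left) 0 (scale k / 4) h) :
    (w n).Run κ (down k i (3 / 4 * scale k + h)) (block k .d i ++ quadTurn k (i - 1) .right)
      (down k (i - 1) (scale k / 2 + h)) := by
  refine (run_block (z := .d) (halfOpen_add H (3 / 4 * scale k) rfl
    (by simp only [Zone.lo]; linarith [scale_pos k])
    (by simp only [Zone.hi]; linarith [scale_pos k]))).append ?_
  rw [show scale k - (3 / 4 * scale k + h) = scale k / 4 - h by ring, Zone.net, ← sub_eq_add_neg]
  exact run_quadTurn_right H

/-- Every block of an orbit is a subblock of a block of the next level. -/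
theorem GoesDown.exists_succ (hσ : (w n).IsOrbit κ σ) {k : ℕ} {a : ℤ} (ha : GoesDown σ k a) :
    ∃ a', GoesDown σ (k + 1) a' ∧ a' + 2 ≤ a ∧
      a + blockLength k + 2 ≤ a' + blockLength (k + 1) ∧
      (a' + blockLength (k + 1) = a + blockLength k + 2 ∨
        GoesDown σ k (a + blockLength k + 4)) := by
  obtain ⟨i, h, ha⟩ := ha
  have hi := (hσ a).1
  rw [ha] at hi
  have hL : ((blockLength (k + 1) : ℕ) : ℤ) = 4 * blockLength k + 16 := by
    simp [blockLength]
  rw [hL]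
  -- Moves from the start of one subblock to the start of the next, or back: the subblock and a turn
  -- of four branches.
  have aux : ∀ {z i i' h' h''} {l : List (T n).DirectedBranch} {b : ℤ},
      (w n).Run κ (down k i h') (block k z i ++ l) (down k i' h'') → l.length = 4 →
      (σ b = down k i h' → σ (b + blockLength k + 4) = down k i' h'') ∧
      (σ b = down k i' h'' → σ (b - (blockLength k + 4)) = down k i h') := by
    intro z i i' h' h'' l b hr hl
    have hlen : ((block k z i ++ l).length : ℤ) = blockLength k + 4 := by simp [hl]
    constructor <;> intro hb
    · rw [← (hσ.run_right hr hb).1, hlen, add_assoc]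
    · rw [← hσ.run_left hr hb, hlen]
  -- Goes back from the start of the second subblock to the start of the whole block: two branches
  -- of descent, the first subblock and one turn.
  have aux₂ : ∀ {z : Zone} {i h'} {b : ℤ}, HalfOpen (upward κ .left) 0 (scale k / 4) h' →
      HalfOpen (upward κ .left) (z.lo * (scale k / 4)) (z.hi * (scale k / 4)) h' →
      σ b = down k i h' → GoesDown σ (k + 1) (b - (2 + (blockLength k + 4))) := by
    intro z i h' b H hz hb
    have hr := run_second (n := n) (i := i - z.first.net) H hz
    rw [sub_add_cancel] at hr
    have := hσ.run_left hr hb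
    have hlen : ((descent k (i - z.first.net) ++ (block k z.first (i - z.first.net) ++
      quadTurn k i .left)).length : ℤ) = 2 + (blockLength k + 4) := by
        simp [descent, quadTurn]; ring
    rw [hlen] at this
    exact ⟨_, _, this⟩
  -- The quarters of `spine k`, from bottom to top, are visited by the second, first, fourth and
  -- third subblock. Only the third quarter gives the last subblock, after which the two branches of
  -- the ascent complete the larger block.
  rcases exists_quarter (inside_down hi) with H | H | H | H
  · obtain ⟨z, hz⟩ := exists_zone H
    exact ⟨_, aux₂ H hz ha, by linarith, by linarith,
      .inr ⟨_, _, (aux (run_third H hz) rfl).1 ha⟩⟩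
  · obtain ⟨z, hz⟩ := exists_zone H
    have hr := run_descent (n := n) (i := i) H
    rw [add_sub_cancel] at hr
    have h₀ := hσ.run_left hr ha
    refine ⟨a - 2, ⟨_, _, h₀⟩, by linarith, by linarith, .inr ?_⟩
    have := (hσ.run_right (run_second (i := i) H hz) h₀).1
    refine ⟨_, _, Eq.trans (congrArg σ ?_) this⟩
    simp [descent, quadTurn]
    ring
  · obtain ⟨z, hz⟩ := exists_zone H
    have hr := run_fourth (n := n) (i := i + 1) H
    rw [add_sub_cancel, add_sub_cancel_right] at hr
    have h₀ := (aux hr rfl).2 ha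
    have h₁ := (aux (run_third H hz) rfl).2 h₀
    exact ⟨_, aux₂ H hz h₁, by linarith, by linarith, .inl (by ring)⟩
  · obtain ⟨z, hz⟩ := exists_zone H
    have hr := run_third (n := n) (i := i - 1) H hz
    rw [add_sub_cancel, sub_add_cancel] at hr
    have h₀ := (aux hr rfl).2 ha
    have hr' := run_fourth (n := n) (i := i) H
    rw [add_sub_cancel] at hr'
    exact ⟨_, aux₂ H hz h₀, by linarith, by linarith, .inr ⟨_, _, (aux hr' rfl).1 ha⟩⟩

/-! ### Every orbit meets the spine -/

theorem step_place {S S' : (T n).DirectedBranch × ℝ} (h : (w n).Step κ S S') :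
    place₁ (S'.1.1.1, S'.1.2) = ((place₁ (S.1.1.1, S.1.2.opp)).1,
      (place₁ (S.1.1.1, S.1.2.opp)).2.opp) := by
  obtain ⟨-, -, v, s, x, ⟨lo, ha, -⟩, ⟨lo', ha', -⟩⟩ := h
  have h₁ := place_unique ha.mem (attachedAt_lift (S.1.1.1, S.1.2.opp) S.1.1.2).mem
  have h₂ := place_unique ha'.mem (attachedAt_lift (S'.1.1.1, S'.1.2) S'.1.1.2).mem
  have h₃ := congrArg Prod.fst (h₁.1.symm.trans h₂.1)
  exact Prod.ext h₃.symm (by rw [← h₂.2, ← h₁.2])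

/-- The combinatorial distance of a branch of `T₁` from the branches `spine k`. -/
def spineDist : Branch₁ → ℕ
  | .spine _ => 0
  | .e₁ | .e₂ | .mid _ | .stem _ => 1
  | .main | .triLoop _ | .quadLoop _ => 2
  | .mainLoop => 3

/-- Each branch off the spine has an end at which all branches across the switch are closer to the
spine. An orbit uses both ends of the branch, so following it through this one, forwards or
backwards, makes the distance drop. -/
theorem exists_end_spineDist_lt {b : Branch₁} (hb : spineDist b ≠ 0) :
    ∃ ε, ∀ f : Branch₁ × End, place₁ f = ((place₁ (b, ε)).1, (place₁ (b, ε)).2.opp) →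
      spineDist f.1 < spineDist b := by
  have key : ∀ ε : End, (∀ f : Branch₁ × End, place₁ f =
      ((place₁ (b, ε)).1, (place₁ (b, ε)).2.opp) → spineDist f.1 < spineDist b) → ∃ ε : End,
      ∀ f : Branch₁ × End, place₁ f = ((place₁ (b, ε)).1, (place₁ (b, ε)).2.opp) →
      spineDist f.1 < spineDist b := fun ε h => ⟨ε, h⟩
  rcases b with _ | _ | _ | _ | k | k | k | k | k
  case' e₁ => apply key .left
  case' e₂ => apply key .left
  case' main => apply key .left
  case' mainLoop => apply key .left
  case' spine => exact absurd rfl hb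
  case' mid => apply key .right
  case' stem => apply key .right
  case' triLoop => apply key .right
  case' quadLoop => apply key .right
  all_goals
    rintro ⟨_ | _ | _ | _ | (_ | j) | j | j | j | j, _ | _⟩ h <;>
      simp [place₁, Side.opp] at h <;> simp [spineDist]

theorem exists_spine (hσ : (w n).IsOrbit κ σ) : ∃ k a, GoesUp σ k a ∨ GoesDown σ k a := by
  suffices ∀ r a, spineDist (σ a).1.1.1 = r → ∃ k a, GoesUp σ k a ∨ GoesDown σ k a from
    this _ 0 rfl
  intro r
  induction r using Nat.strong_induction_on with
  | _ r ih =>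
    intro a ha
    by_cases hr : spineDist (σ a).1.1.1 = 0
    · rcases hS : σ a with ⟨⟨⟨b, i⟩, ε⟩, h⟩
      rw [hS] at hr
      rcases b with _ | _ | _ | _ | k | k | k | k | k
      case spine =>
        cases ε
        · exact ⟨k, a, .inr ⟨i, h, hS⟩⟩
        · exact ⟨k, a, .inl ⟨i, h, hS⟩⟩
      all_goals simp [spineDist] at hr
    · obtain ⟨ε, hε⟩ := exists_end_spineDist_lt hr
      have hε' : ε = (σ a).1.2.opp ∨ ε = (σ a).1.2 := by
        cases ε <;> cases (σ a).1.2 <;> simp [End.opp]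
      rcases hε' with rfl | rfl
      · exact ih _ (ha ▸ hε _ (step_place (hσ a))) _ rfl
      · have := hσ (a - 1)
        rw [sub_add_cancel] at this
        refine ih _ (ha ▸ hε ((σ (a - 1)).1.1.1, (σ (a - 1)).1.2.opp) ?_) _ rfl
        rw [step_place this, Side.opp_opp]

/-- The blocks of increasing levels around a point of an orbit. -/
theorem exists_blocks (hσ : (w n).IsOrbit κ σ) : ∃ (k₀ : ℕ) (A : ℕ → ℤ), ∀ m,
    GoesDown σ (k₀ + m) (A m) ∧ A (m + 1) + 2 ≤ A m ∧
      A m + blockLength (k₀ + m) + 2 ≤ A (m + 1) + blockLength (k₀ + m + 1) ∧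
      (A (m + 1) + blockLength (k₀ + m + 1) = A m + blockLength (k₀ + m) + 2 ∨
        GoesDown σ (k₀ + m) (A m + blockLength (k₀ + m) + 4)) := by
  obtain ⟨k₀, a₀, h₀⟩ : ∃ k a, GoesDown σ k a := by
    obtain ⟨k, a, h | h⟩ := exists_spine hσ
    · exact ⟨_, _, h.goesDown hσ⟩
    · exact ⟨_, _, h⟩
  -- `f` sends the start of a block to the start of the block of the next level containing it.
  choose! f hf using fun (k : ℕ) (a : ℤ) (h : GoesDown σ k a) => h.exists_succ hσ
  let A : ℕ → ℤ := Nat.rec a₀ fun m a => f (k₀ + m) a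
  have hA : ∀ m, GoesDown σ (k₀ + m) (A m) := by
    intro m
    induction m with
    | zero => exact h₀
    | succ m ih => exact (hf _ _ ih).1
  exact ⟨k₀, A, fun m => ⟨hA m, (hf _ _ (hA m)).2⟩⟩

/-- The blocks around a point of an orbit exhaust the orbit. -/
theorem exists_blocks_le {k₀ : ℕ} {A : ℕ → ℤ} (hA : ∀ m, A (m + 1) + 2 ≤ A m)
    (hA' : ∀ m, A m + blockLength (k₀ + m) + 2 ≤ A (m + 1) + blockLength (k₀ + m + 1))
    (c d : ℤ) : ∃ M, ∀ m ≥ M, A m ≤ c ∧ d ≤ A m + blockLength (k₀ + m) := by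
  have h₁ : ∀ m : ℕ, A m ≤ A 0 - 2 * m := by
    intro m
    induction m with
    | zero => simp
    | succ m ih => push_cast; linarith [hA m]
  have h₂ : ∀ m : ℕ, A 0 + 2 * m ≤ A m + blockLength (k₀ + m) := by
    intro m
    induction m with
    | zero => simp
    | succ m ih => push_cast; rw [← add_assoc k₀]; linarith [hA' m]
  refine ⟨(A 0 - c).toNat + (d - A 0).toNat, fun m hm => ?_⟩
  have := h₁ m
  have := h₂ m
  omega

/-! ## Primitivity -/

theorem block_first_infix (k : ℕ) (z : Zone) (i : ZMod n) :
    block k z.first i <:+: block (k + 1) z i :=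
  ⟨descent k i, _, by rw [block, List.append_assoc]⟩

theorem block_a_infix (k : ℕ) (z : Zone) (i : ZMod n) :
    block k .a (i + z.first.net) <:+: block (k + 1) z i :=
  ⟨descent k i ++ (block k z.first i ++ quadTurn k (i + z.first.net) .left), _, by
    simp only [block, List.append_assoc]; rfl⟩

theorem block_d_infix (k : ℕ) (z : Zone) (i : ZMod n) :
    block k .d (i + z.first.net + 1) <:+: block (k + 1) z i :=
  ⟨descent k i ++ (block k z.first i ++ (quadTurn k (i + z.first.net) .left ++
      (block k .a (i + z.first.net) ++ triTurn k (i + z.first.net + 1) z.loopEnd))), _, by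
    simp only [block, List.append_assoc]; rfl⟩

theorem block_last_infix (k : ℕ) (z : Zone) (i : ZMod n) :
    block k z.last (i + z.first.net) <:+: block (k + 1) z i :=
  ⟨descent k i ++ (block k z.first i ++ (quadTurn k (i + z.first.net) .left ++
      (block k .a (i + z.first.net) ++ (triTurn k (i + z.first.net + 1) z.loopEnd ++
        (block k .d (i + z.first.net + 1) ++ quadTurn k (i + z.first.net) .right))))), _, by
    simp only [block, List.append_assoc]; rfl⟩

/-- The second subblock of a block of zone `a` is again of zone `a`, one sheet further, because the
first subblock has net shift `1`. The first subblock stays on the sheet. Using the former `j` times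
and the latter `m` times reaches any prescribed sheet at any higher level. -/
theorem block_a_infix_block_a (k j m : ℕ) (i : ZMod n) :
    block k .a (i + (j : ZMod n)) <:+: block (k + j + m) .a i := by
  induction j generalizing k with
  | zero =>
    rw [Nat.cast_zero, add_zero, add_zero]
    induction m with
    | zero => exact List.infix_refl _
    | succ m ih => exact ih.trans (block_first_infix (k + m) .a i)
  | succ j ih =>
    have := block_a_infix k .a (i + (j : ZMod n))
    have h := ih (k + 1)
    rw [show k + (j + 1) + m = k + 1 + j + m by ring, Nat.cast_succ, ← add_assoc]
    exact this.trans h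

/-- Blocks of the zones `a`, `c` and `d` already occur one level up in zone `a`. Zone `b` needs two
levels: it is the first subblock of zone `c`, which is the last subblock of zone `a`. -/
theorem exists_block_infix_block_a (k : ℕ) (z : Zone) (i : ZMod n) :
    ∃ i', block k z i <:+: block (k + 2) .a i' := by
  have hf : ∀ i : ZMod n, block (k + 1) .a i <:+: block (k + 2) .a i :=
    block_first_infix (k + 1) .a
  cases z with
  | a => exact ⟨i, (block_first_infix k .a i).trans (hf i)⟩
  | b =>
    refine ⟨i - 1, (block_first_infix k .c i).trans ?_⟩
    have := block_last_infix (k + 1) .a (i - 1)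
    simpa [Zone.first, Zone.last, Zone.net] using this
  | c =>
    refine ⟨i - 1, List.IsInfix.trans ?_ (hf _)⟩
    have := block_last_infix k .a (i - 1)
    simpa [Zone.first, Zone.last, Zone.net] using this
  | d =>
    refine ⟨i - 1 - 1, List.IsInfix.trans ?_ (hf _)⟩
    have := block_d_infix k .a (i - 1 - 1)
    simpa [Zone.first, Zone.net] using this

/-- Every block is contained in all blocks of sufficiently high levels. -/
theorem block_infix_block [NeZero n] {k K : ℕ} (hK : k + n + 3 ≤ K) (z z' : Zone)
    (i i' : ZMod n) : block k z i <:+: block K z' i' := by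
  obtain ⟨K, rfl⟩ : ∃ K', K = K' + 1 := ⟨K - 1, by omega⟩
  obtain ⟨i₁, h₁⟩ := exists_block_infix_block_a k z i
  refine h₁.trans (List.IsInfix.trans ?_ (block_a_infix K z' i'))
  -- The level bound leaves room for two levels to reach zone `a`, at most `n - 1` changes of sheet,
  -- and one level to enter zone `a` from `z'`.
  have hlt := (i₁ - (i' + z'.first.net)).val_lt
  have := block_a_infix_block_a (k + 2) (i₁ - (i' + z'.first.net)).val
    (K - (k + 2 + (i₁ - (i' + z'.first.net)).val)) (i' + z'.first.net)
  rwa [ZMod.natCast_zmod_val, add_sub_cancel, Nat.add_sub_cancel' (by omega)] at this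

/-! ## Density -/

theorem readsIn_of_infix {T : TrainTrack} {t : ℤ → T.DirectedBranch} {S : Set ℤ}
    {u l : List T.DirectedBranch} (hu : u <:+: l) {a : ℤ}
    (hS : ∀ j : ℕ, j < l.length → a + j ∈ S)
    (hl : ∀ (j : ℕ) (hj : j < l.length), t (a + j) = l[j]) : ReadsIn t S u := by
  obtain ⟨p, q, rfl⟩ := hu
  refine ⟨a + p.length, fun j => ?_⟩
  have hj : p.length + (j : ℕ) < (p ++ u ++ q).length := by
    simp only [List.length_append]
    omega
  have h₁ := hS _ hj
  have h₂ := hl _ hj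
  push_cast at h₁ h₂
  rw [← add_assoc] at h₁ h₂
  refine ⟨h₁, h₂.trans ?_⟩
  simp

theorem infix_of_readsIn {T : TrainTrack} {t : ℤ → T.DirectedBranch} {u l : List T.DirectedBranch}
    {a c : ℤ} (hu : ∀ j : Fin u.length, t (c + (j : ℤ)) = u.get j) (hac : a ≤ c)
    (hca : c + u.length ≤ a + l.length)
    (hl : ∀ (j : ℕ) (hj : j < l.length), t (a + j) = l[j]) : u <:+: l := by
  obtain ⟨d, rfl⟩ := Int.le.dest hac
  have : u = (l.drop d).take u.length := by
    apply List.ext_getElem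
    · simp
      omega
    · intro j h₁ h₂
      have := hu ⟨j, h₁⟩
      rw [List.get_eq_getElem] at this
      rw [← this, List.getElem_take, List.getElem_drop, ← hl (d + j) (by omega)]
      congr 1
      push_cast
      ring
  rw [this]
  exact (List.take_prefix _ _).isInfix.trans (List.drop_suffix _ _).isInfix

/-- The nested blocks around a point of the orbit grow without bound in both directions, so one of
them covers the given finite piece. -/
theorem exists_block_of_readsIn (hσ : (w n).IsOrbit κ σ) {u : List (T n).DirectedBranch}
    (hu : ReadsIn (fun i => (σ i).1) Set.univ u) : ∃ k z i, u <:+: block k z i := by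
  obtain ⟨c, hc⟩ := hu
  obtain ⟨k₀, A, hA⟩ := exists_blocks hσ
  obtain ⟨M, hM⟩ := exists_blocks_le (fun m => (hA m).2.1) (fun m => (hA m).2.2.1) c
    (c + u.length)
  obtain ⟨h₁, h₂⟩ := hM M le_rfl
  obtain ⟨-, z, i, h⟩ := (hA M).1.exists_block hσ
  exact ⟨_, z, i, infix_of_readsIn (t := fun i => (σ i).1) (fun j => (hc j).2) h₁ (by simpa using h₂) h⟩

theorem mem_TP_iff_isOrbit {t : ℤ → (T n).DirectedBranch} :
    t ∈ (w n).TP ↔ ∃ κ σ, (w n).IsOrbit κ σ ∧ t = fun i => (σ i).1 := by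
  rw [mem_TP_iff ends_singleton weight_pos]
  simp only [funext_iff]

/-- An orbit which contains blocks of arbitrarily high levels in the set `S` of indices accumulates
onto every train path along `S`. -/
theorem accumulatesOnto_of_forall_exists [NeZero n] (hσ : (w n).IsOrbit κ σ) {S : Set ℤ}
    (hS : ∀ K, ∃ k ≥ K, ∃ a, GoesDown σ k a ∧ ∀ j : ℕ, j < blockLength k → a + j ∈ S)
    {t : ℤ → (T n).DirectedBranch} (ht : t ∈ (w n).TP) :
    AccumulatesOnto (fun i => (σ i).1) S t := by
  obtain ⟨κ', σ', hσ', rfl⟩ := mem_TP_iff_isOrbit.1 ht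
  have key : ∀ u, ReadsIn (fun i => (σ' i).1) Set.univ u → ReadsIn (fun i => (σ i).1) S u := by
    intro u hu
    obtain ⟨k, z, i, h⟩ := exists_block_of_readsIn hσ' hu
    obtain ⟨K, hK, a, ha, haS⟩ := hS (k + n + 3)
    obtain ⟨-, z', i', h'⟩ := ha.exists_block hσ
    exact readsIn_of_infix (h.trans (block_infix_block hK z z' i i'))
      (by simpa using haS) h'
  intro u hu
  exact hu.imp (key _) (key _)

theorem isDense_of_mem_TP [NeZero n] {t : ℤ → (T n).DirectedBranch} (ht : t ∈ (w n).TP) :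
    (w n).IsDense t := by
  obtain ⟨κ, σ, hσ, rfl⟩ := mem_TP_iff_isOrbit.1 ht
  intro t' ht'
  obtain ⟨k₀, A, hA⟩ := exists_blocks hσ
  exact accumulatesOnto_of_forall_exists hσ
    (fun K => ⟨k₀ + K, by omega, A K, (hA K).1, fun _ _ => Set.mem_univ _⟩) ht'

end CoverTrack

namespace CoverTrack

open TrainTrack WeightSystem

variable {n : ℕ} {κ : Hand} {σ : ℤ → (T n).DirectedBranch × ℝ}

/-! ## The orbits which escape along the spine -/

/-- An upward passage of `spine (k + 1)` can only come from an ascent, so its past on `spine k` is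
determined. -/
theorem eq_up_of_eq_up_succ (hσ : (w n).IsOrbit κ σ) {k : ℕ} {i : ZMod n} {h : ℝ} {a : ℤ}
    (ha : σ a = up (k + 1) i h) : σ (a - 2) = up k i (scale k / 4 + h) := by
  have hi := (hσ a).1
  rw [ha] at hi
  have hi := inside_up hi
  have hs : HalfOpen (upward κ .left) 0 (scale k / 4) (scale k / 4 - h) := by
    rw [← Bool.not_not (upward κ .left), ← upward_right]
    rw [scale_succ] at hi
    exact halfOpen_not hi (scale k / 4) rfl (by simp) (by simp)
  have hr := run_ascent (n := n) (i := i) hs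
  rw [sub_sub_cancel, show scale k / 2 - (scale k / 4 - h) = scale k / 4 + h by ring] at hr
  exact hσ.run_left hr ha

/-- Each ascent lowers the height by a quarter of the scale; `(1 - scale k) / 3` is the sum of these
losses over the levels below `k`. -/
theorem eq_up_zero (hσ : (w n).IsOrbit κ σ) {k : ℕ} {i : ZMod n} {h : ℝ} {a : ℤ}
    (ha : σ (a + 2 * k) = up k i h) : σ a = up 0 i (h + (1 - scale k) / 3) := by
  induction k generalizing h with
  | zero => simpa using ha
  | succ k ih =>
    have h₁ := eq_up_of_eq_up_succ hσ ha
    rw [show a + 2 * ((k + 1 : ℕ) : ℤ) - 2 = a + 2 * k by push_cast; ring] at h₁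
    rw [ih h₁, scale_succ]
    congr 1
    ring

/-- An orbit which escapes along the spine passes `spine 0` at the height `1/3`. -/
theorem eq_up_zero_of_escape (hσ : (w n).IsOrbit κ σ) {a : ℤ} {K : ℕ}
    (ha : ∀ k ≥ K, GoesUp σ k (a + 2 * k)) : ∃ i, σ a = up 0 i (1 / 3) := by
  obtain ⟨i, h, hK⟩ := ha K le_rfl
  refine ⟨i, ?_⟩
  have h₀ := eq_up_zero hσ hK
  rw [h₀]
  congr 1
  set x := h + (1 - scale K) / 3
  -- The height `h'` on `spine k` lies between `0` and `scale k`, and `x - 1/3 = h' - scale k / 3`.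
  have hbound : ∀ k ≥ K, |x - 1 / 3| ≤ scale k := by
    intro k hk
    obtain ⟨i', h', hk'⟩ := ha k hk
    have h₁ := eq_up_zero hσ hk'
    have hx : x = h' + (1 - scale k) / 3 := congrArg Prod.snd (h₀.symm.trans h₁)
    have hi := (hσ (a + 2 * k)).1
    rw [hk'] at hi
    have := (inside_up hi).mem_Icc
    rw [abs_le]
    constructor <;> linarith [this.1, this.2, scale_pos k]
  have hlim : Filter.Tendsto scale Filter.atTop (nhds 0) := by
    have := tendsto_pow_atTop_nhds_zero_of_lt_one (r := (1 / 4 : ℝ)) (by norm_num) (by norm_num)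
    refine this.congr fun k => ?_
    rw [scale, one_div_pow]
  have := ge_of_tendsto hlim (Filter.eventually_atTop.2 ⟨K, hbound⟩)
  rw [abs_nonpos_iff] at this
  linarith

/-- An orbit which does not escape along the spine contains blocks of all levels arbitrarily far
away. -/
theorem exists_goesDown_or_escape (hσ : (w n).IsOrbit κ σ) (r : ℤ) :
    (∀ K, ∃ k ≥ K, ∃ a, GoesDown σ k a ∧ r ≤ a) ∨ ∃ a i, σ a = up 0 i (1 / 3) := by
  by_contra! hcon
  obtain ⟨⟨K, hK⟩, hup⟩ := hcon
  obtain ⟨k₀, A, hA⟩ := exists_blocks hσ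
  obtain ⟨M, hM⟩ := exists_blocks_le (fun m => (hA m).2.1) (fun m => (hA m).2.2.1) r r
  set m₀ := max M K
  -- Beyond the level `m₀`, a block that is not the last of its four would be followed by another
  -- block of the same level starting after `r`, contrary to `hK`. Hence the ends of the blocks
  -- advance by just two branches per level.
  have hend : ∀ j : ℕ, A (m₀ + j) + blockLength (k₀ + (m₀ + j)) =
      A m₀ + blockLength (k₀ + m₀) + 2 * j := by
    intro j
    induction j with
    | zero => simp
    | succ j ih =>
      rcases (hA (m₀ + j)).2.2.2 with h | h
      · rw [← add_assoc m₀, ← add_assoc k₀, h, ih]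
        push_cast
        ring
      · have h₁ := hK (k₀ + (m₀ + j)) (by omega) _ h
        have h₂ := (hM (m₀ + j) (by omega)).2
        omega
  -- The ascent takes two branches per level, so extrapolating down from level `k₀ + m₀` gives the
  -- index at which `spine 0` is passed.
  obtain ⟨i, hi⟩ := eq_up_zero_of_escape hσ
    (a := A m₀ + blockLength (k₀ + m₀) - 2 * (k₀ + m₀ : ℕ)) (K := k₀ + m₀) (by
      intro k hk
      obtain ⟨j, rfl⟩ : ∃ j, k = k₀ + (m₀ + j) := ⟨k - (k₀ + m₀), by omega⟩
      have := ((hA (m₀ + j)).1.exists_block hσ).1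
      rw [hend] at this
      convert this using 1
      push_cast
      ring)
  exact hup _ _ hi

/-- The height `1/3` is interior to the rectangle of `spine 0`, so it carries a leaf on either hand.
-/
theorem inside_up_third (κ : Hand) (i : ZMod n) : (w n).Inside κ (up 0 i (1 / 3)) := by
  change HalfOpen (upward κ .right) 0 (weight₁ (.spine 0)) (1 / 3)
  rw [weight₁_spine, scale_zero]
  cases κ <;> constructor <;> norm_num

/-- The orbit on the hand `κ` which escapes along the spine on the sheet `i` after the index `0`. -/
noncomputable def escapeOrbit (κ : Hand) (i : ZMod n) : ℤ → (T n).DirectedBranch × ℝ :=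
  (exists_isOrbit (inside_up_third κ i)).choose

theorem isOrbit_escapeOrbit (κ : Hand) (i : ZMod n) : (w n).IsOrbit κ (escapeOrbit κ i) :=
  (exists_isOrbit (inside_up_third κ i)).choose_spec.1

theorem escapeOrbit_zero (κ : Hand) (i : ZMod n) : escapeOrbit κ i 0 = up 0 i (1 / 3) :=
  (exists_isOrbit (inside_up_third κ i)).choose_spec.2

theorem escapeOrbit_even_odd (κ : Hand) (i : ZMod n) (k : ℕ) :
    escapeOrbit κ i (2 * k) = up k i (scale k / 3) ∧
      (escapeOrbit κ i (2 * k + 1)).1 = lift (.mid k) i .right := by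
  have hodd : ∀ k : ℕ, escapeOrbit κ i (2 * k) = up k i (scale k / 3) →
      escapeOrbit κ i (2 * k + 2) = up (k + 1) i (scale (k + 1) / 3) ∧
        (escapeOrbit κ i (2 * k + 1)).1 = lift (.mid k) i .right := by
    intro k hk
    have hs := scale_pos k
    -- One third of the scale is preserved by an ascent: `1/3 = 1/2 - 1/6` of the scale on `spine k`
    -- becomes `1/4 - 1/6 = 1/12`, one third of the scale of `spine (k + 1)`.
    have hr := run_ascent (n := n) (κ := κ) (i := i) (k := k) (h := scale k / 6)
      (by cases κ <;> constructor <;> linarith)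
    rw [show scale k / 2 - scale k / 6 = scale k / 3 by ring,
      show scale k / 4 - scale k / 6 = scale (k + 1) / 3 by rw [scale_succ]; ring] at hr
    obtain ⟨h₁, h₂⟩ := (isOrbit_escapeOrbit κ i).run_right hr hk
    exact ⟨h₁, h₂ 1 (by simp [ascent])⟩
  have heven : escapeOrbit κ i (2 * k) = up k i (scale k / 3) := by
    induction k with
    | zero => simpa using escapeOrbit_zero κ i
    | succ k ih =>
      rw [← (hodd k ih).1]
      congr 1
  exact ⟨heven, (hodd k heven).2⟩

/-- The branches which an escaping orbit passes after the index `0`. -/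
theorem escapeOrbit_branch (κ : Hand) (i : ZMod n) {j : ℤ} (hj : 0 < j) :
    (∃ k, (escapeOrbit κ i j).1 = lift (.spine (k + 1)) i .right) ∨
      ∃ k, (escapeOrbit κ i j).1 = lift (.mid k) i .right := by
  obtain ⟨m, hm | hm⟩ := Int.even_or_odd' j
  · obtain ⟨k, rfl⟩ : ∃ k : ℕ, m = k + 1 := ⟨(m - 1).toNat, by omega⟩
    left
    refine ⟨k, ?_⟩
    have := (escapeOrbit_even_odd κ i (k + 1)).1
    rw [hm]
    push_cast at this
    rw [this]
    rfl
  · obtain ⟨k, rfl⟩ : ∃ k : ℕ, m = k := ⟨m.toNat, by omega⟩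
    exact .inr ⟨k, hm ▸ (escapeOrbit_even_odd κ i k).2⟩

/-- Going backwards from the height `1/3`, the leaf meets the singularity between `e₁` and `e₂`. The
left hand arrives along the top of `e₁`, the right hand along the bottom of `e₂`. -/
theorem escapeOrbit_neg_one (κ : Hand) (i : ZMod n) :
    (escapeOrbit κ i (-1)).1 = match κ with
      | .left => lift .e₁ i .right
      | .right => lift .e₂ i .right := by
  have h := isOrbit_escapeOrbit κ i (-1)
  rw [neg_add_cancel, escapeOrbit_zero] at h
  cases κ with
  | left =>
    have := step_e₁_spine_zero (κ := .left) (i := i) (h := 1 / 3) (by constructor <;> norm_num)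
    rw [h.left_unique this]
  | right =>
    have := step_e₂_spine_zero (κ := .right) (i := i) (h := 0) (by constructor <;> norm_num)
    rw [zero_add] at this
    rw [h.left_unique this]

/-- The train path of an escaping orbit. -/
noncomputable def escapePath (κ : Hand) (i : ZMod n) : (w n).TP :=
  ⟨fun j => (escapeOrbit κ i j).1,
    mem_TP_iff_isOrbit.2 ⟨κ, _, isOrbit_escapeOrbit κ i, rfl⟩⟩

/-- The half train path along which an orbit escapes. -/
noncomputable def escapeHalf (x : Bool × ZMod n) : (w n).HalfTrainPath :=
  Quotient.mk (w n).raySetoid (escapePath (if x.1 then .left else .right) x.2, 0)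

/-- An escaping path does not pass `spine 0` after the index `0`, so neither path can be a proper
shift of the other. The branch at the index `-1` then reveals both the hand and the sheet. -/
theorem escapePath_shift {κ κ' : Hand} {i i' : ZMod n} {c : ℤ}
    (h : ∀ j, (escapePath κ' i').1 j = (escapePath κ i).1 (j + c)) : κ' = κ ∧ i' = i := by
  have key : ∀ {κ κ' : Hand} {i i' : ZMod n} {c : ℤ},
      (∀ j, (escapePath κ' i').1 j = (escapePath κ i).1 (j + c)) → c ≤ 0 := by
    intro κ κ' i i' c h
    by_contra! hc
    have h₀ := h 0
    rw [zero_add] at h₀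
    simp only [escapePath, escapeOrbit_zero, up] at h₀
    have h₀ := congrArg (fun d : (T n).DirectedBranch => d.1.1) h₀
    rcases escapeOrbit_branch κ i hc with ⟨k, hk⟩ | ⟨k, hk⟩ <;> rw [hk] at h₀ <;>
      cases h₀
  have hc : c = 0 := by
    refine le_antisymm (key h) ?_
    have := key (c := -c) (κ := κ') (κ' := κ) (i := i') (i' := i) fun j => by
      rw [h, neg_add_cancel_right]
    linarith
  subst hc
  have h₁ := h (-1)
  rw [add_zero] at h₁
  simp only [escapePath, escapeOrbit_neg_one] at h₁
  cases κ <;> cases κ' <;> cases h₁ <;> exact ⟨rfl, rfl⟩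

theorem escapeHalf_injective : Function.Injective (escapeHalf (n := n)) := by
  rintro ⟨x, i⟩ ⟨x', i'⟩ h
  obtain ⟨c, hc⟩ := Quotient.exact h
  obtain ⟨h₁, rfl⟩ := escapePath_shift hc
  cases x <;> cases x' <;> first | rfl | cases h₁

/-- From the index `0` on, the path uses only branches `spine k` and `mid k`, and never the branch
of the bigon at the index `-1`, in either direction. -/
theorem not_accumulatesOnto_escapePath (κ : Hand) (i : ZMod n) :
    ¬ AccumulatesOnto (escapePath κ i).1 (Set.Ici 0) (escapePath κ i).1 := by
  intro h
  have hacc := h [(escapePath κ i).1 (-1)] (.inl ⟨-1, fun j => ⟨trivial, by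
    obtain ⟨j, hj⟩ := j
    obtain rfl : j = 0 := by simpa using hj
    simp⟩⟩)
  obtain ⟨j, hj, hbr⟩ :
      ∃ j ≥ 0, ((escapePath κ i).1 j).1 = ((escapePath κ i).1 (-1)).1 := by
    rcases hacc with ⟨c, hc⟩ | ⟨c, hc⟩
    · have := hc ⟨0, by simp⟩
      exact ⟨_, this.1, congrArg Prod.fst this.2⟩
    · have := hc ⟨0, by simp⟩
      exact ⟨_, this.1, by simpa [DirectedBranch.flip] using congrArg Prod.fst this.2⟩
  simp only [escapePath, escapeOrbit_neg_one] at hbr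
  have hbr := congrArg Prod.fst hbr
  rcases hj.eq_or_lt with rfl | hj
  · rw [escapeOrbit_zero] at hbr
    cases κ <;> cases hbr
  · rcases escapeOrbit_branch κ i hj with ⟨k, hk⟩ | ⟨k, hk⟩ <;> rw [hk] at hbr <;>
      cases κ <;> cases hbr

theorem not_isDense_escapeHalf (x : Bool × ZMod n) : ¬ (escapeHalf x).IsDense := fun h =>
  not_accumulatesOnto_escapePath _ _ (h _ rfl _ (escapePath _ _).2)

/-- A ray without blocks of arbitrarily high level belongs to an orbit through height `1/3` of
`spine 0`. By determinism this orbit is, up to a shift, the escaping orbit with the same hand and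
sheet. -/
theorem exists_escapeHalf [NeZero n] {H : (w n).HalfTrainPath} (hH : ¬ H.IsDense) :
    ∃ x, escapeHalf x = H := by
  simp only [HalfTrainPath.IsDense, not_forall] at hH
  obtain ⟨r, rfl, t', ht', hacc⟩ := hH
  obtain ⟨κ, σ, hσ, hr⟩ := mem_TP_iff_isOrbit.1 r.1.2
  rcases exists_goesDown_or_escape hσ r.2 with h | ⟨a, i, ha⟩
  · refine absurd ?_ hacc
    rw [hr]
    refine accumulatesOnto_of_forall_exists hσ (fun K => ?_) ht'
    obtain ⟨k, hk, a, hka, ha⟩ := h K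
    exact ⟨k, hk, a, hka, fun j _ => by
      have : (0 : ℤ) ≤ j := j.cast_nonneg
      exact Set.mem_Ici.2 (by linarith)⟩
  · obtain ⟨x, rfl⟩ : ∃ x : Bool, (if x then .left else .right) = κ := by
      cases κ
      exacts [⟨true, rfl⟩, ⟨false, rfl⟩]
    refine ⟨(x, i), Quotient.sound ⟨-a, fun j => ?_⟩⟩
    have := (isOrbit_escapeOrbit _ i).eq (hσ.shift a) (by
      rw [escapeOrbit_zero, zero_add, ha])
    simp only [escapePath, hr, this, neg_add_cancel_right]

end CoverTrack

/-! ### Conclusion: counting by hand and sheet -/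

theorem mainTheorem7 (n : ℕ) (hn : 1 ≤ n) :
    (∀ t ∈ (CoverTrack.w n).TP, (CoverTrack.w n).IsDense t) ∧
      {H : (CoverTrack.w n).HalfTrainPath | ¬ H.IsDense}.encard = 2 * (n : ℕ∞) := by
  have : NeZero n := ⟨by omega⟩
  refine ⟨fun t ht => CoverTrack.isDense_of_mem_TP ht, ?_⟩
  have hset : {H : (CoverTrack.w n).HalfTrainPath | ¬ H.IsDense} =
      Set.range CoverTrack.escapeHalf := by
    ext H
    constructor
    · exact CoverTrack.exists_escapeHalf
    · rintro ⟨x, rfl⟩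
      exact CoverTrack.not_isDense_escapeHalf x
  rw [hset, ← Set.image_univ, CoverTrack.escapeHalf_injective.encard_image, Set.encard_univ,
    ENat.card_eq_coe_fintype_card,
    Fintype.card_prod, Fintype.card_bool, ZMod.card]
  push_cast
  rfl
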